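/- **Setting.** Let $D\subset\mathbb R^d$ be a closed unbounded cone ($cz\in D$ for $z\in D$, $c\ge 0$) of nonzero Lebesgue measure, and let $w=\exp(-2Q)$ on $D$, where $Q:D\to\mathbb R$ is measurable, $\liminf_{|z|\to\infty}Q(z)/|z|>0$, and $Q(cz)=c^tQ(z)$ for all $z\in D$, $c>0$, with a constant $t\ge 1$. Write $\|g\|_\omega^2=\int_D g^2\,\omega\,dz$ for a weight $\omega$ on $D$. Let $\mu_{D,Q}=(2\pi)^{-d}(dd^cV^*_{D,Q})^d$ be the weighted pluripotential equilibrium measure, where $V^*_{D,Q}$ is the upper semicontinuous regularization of $V_{D,Q}=\sup\{u : u \text{ plurisubharmonic on } \mathbb C^d,\ u(z)\le\max\{\log|z|,0\}+C_u,\ u\le Q\text{ on }D\}$, and assume that $\mu_{D,Q}$ has a Lebesgue density $v_{D,Q}$. Let $\phi_\alpha$ ($\alpha\in\mathbb N_0^d$) be polynomials with $\deg\phi_\alpha=|\alpha|$ that are orthonormal in $L^2_w(D)$. Let $\Lambda\subset\mathbb N_0^d$ be a finite set with $k=\max_{\alpha\in\Lambda}|\alpha|\ge 1$, and put $N=|\Lambda|$,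 $P=\mathrm{span}\{\phi_\alpha:\alpha\in\Lambda\}$, $K=\sum_{\alpha\in\Lambda}\phi_\alpha^2$, $v(z)=k^{-d/t}v_{D,Q}(k^{-1/t}z)$ and $\widetilde w=vN/K$. Let $\mathbf R$ be the Gramian matrix $R_{\alpha,\beta}=\int_D\phi_\alpha\phi_\beta\widetilde w\,dz$ ($\alpha,\beta\in\Lambda$), with extreme eigenvalues $\lambda_{\min}(\mathbf R)$, $\lambda_{\max}(\mathbf R)$ and $\kappa(\mathbf R)=\lambda_{\max}(\mathbf R)/\lambda_{\min}(\mathbf R)$. Let $\Pi$ and $\widetilde\Pi$ be the orthogonal projections onto $P$ in $L^2_w$ and in $L^2_{\widetilde w}$, and put $d(f)=\|\widetilde\Pi f-\Pi f\|_w$. CLS algorithm: draw $y_1,\dots,y_S$ iid from $\mu_{D,Q}$, set $z_s=k^{1/t}y_s$, and let $\widetilde\Pi^Sf$ be a minimizer over $p\in P$ of $\frac1S\sum_{s=1}^S\frac{N}{K(z_s)}|f(z_s)-p(z_s)|^2$. For $L\ge 0$ let $T_L(x)=\mathrm{sgn}(x)\min\{|x|,L\}$. **Theorem.** Let $f\in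 L^2_w$ with $|f|\le L$ on $D$, let $r>0$, and let $S\ge 2$ satisfy $$\frac{S}{N\log S}\ \ge\ \frac{1+r}{c_{1/2}}\,\frac1{\lambda_{\min}(\mathbf R)},\qquad c_\delta=\delta+(1-\delta)\log(1-\delta).$$ Then $\widetilde f=T_L\widetilde\Pi^Sf$ satisfies $$\mathbb E\,\|f-\widetilde f\|_w^2\ \le\ \|f-\Pi f\|_w^2+\frac{\varepsilon(S)}{\lambda_{\min}(\mathbf R)}\|f-\Pi f\|_{\widetilde w}^2+\frac{8L^2}{S^r}\int_Dw\,dz+4\kappa^2(\mathbf R)\,d^2(f),$$ where $\varepsilon(S)=\frac{2-2\log2}{(1+r)\log S}\to0$ as $S\to\infty$. In particular, if $\int_Dw\,dz\le 1$ (for example if $w$ is a probability density), then $$\mathbb E\,\|f-\widetilde f\|_w^2\ \le\ \|f-\Pi f\|_w^2+\frac{\varepsilon(S)}{\lambda_{\min}(\mathbf R)}\|f-\Pi f\|_{\widetilde w}^2+\frac{8L^2}{S^r}+4\kappa^2(\mathbf R)\,d^2(f).$$ (The right-hand sides are $+\infty$ if $f\notin L^2_{\widetilde w}$.) -/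

import Mathlib

open MeasureTheory ProbabilityTheory Filter Topology
open scoped ENNReal

noncomputable section

namespace CLS

/-! ### Weighted pluripotential theory on `ℂ^d` -/

/-- A function `u : ℂ^d → [-∞, ∞)` is plurisubharmonic if it is upper semicontinuous and satisfies
the sub-mean value inequality on every circle `a + e^{iθ} b` of every complex line. The average of
`u` over a circle is the decreasing limit of the averages of the bounded functions `max u c` as
`c → -∞`, so the inequality is required for all these truncations. -/
def Plurisubharmonic {d : ℕ} (u : (Fin d → ℂ) → EReal) : Prop :=
  UpperSemicontinuous u ∧ (∀ z, u z ≠ ⊤) ∧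
    ∀ (a b : Fin d → ℂ) (c : ℝ),
      u a ≤ ((Real.circleAverage
        (fun ζ : ℂ => (max (u (a + ζ • b)) (c : EReal)).toReal) 0 1 : ℝ) : EReal)

/-- The class of plurisubharmonic functions of at most logarithmic growth:
`u(z) ≤ max {log |z|, 0} + C`, with `|z|` the Euclidean norm on `ℂ^d`. -/
def logClass (d : ℕ) : Set ((Fin d → ℂ) → EReal) :=
  {u | Plurisubharmonic u ∧ ∃ C : ℝ, ∀ z : Fin d → ℂ,
    u z ≤ ((max (Real.log (Real.sqrt (∑ i, ‖z i‖ ^ 2))) 0 + C : ℝ) : EReal)}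

/-- The inclusion `ℝ^d ⊂ ℂ^d`. -/
def toComplex {d : ℕ} (x : Fin d → ℝ) : Fin d → ℂ := fun i => (x i : ℂ)

/-- The weighted extremal function `V_{D,Q}`. -/
def extremalFunction {d : ℕ} (D : Set (Fin d → ℝ)) (Q : (Fin d → ℝ) → ℝ)
    (z : Fin d → ℂ) : EReal :=
  ⨆ u ∈ {u | u ∈ logClass d ∧ ∀ x ∈ D, u (toComplex x) ≤ (Q x : EReal)}, u z

/-- The upper semicontinuous regularization `V*_{D,Q}`. -/
def regExtremalFunction {d : ℕ} (D : Set (Fin d → ℝ)) (Q : (Fin d → ℝ) → ℝ)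
    (z : Fin d → ℂ) : EReal :=
  limsup (extremalFunction D Q) (𝓝 z)

/-- The complex Hessian `(∂²u / ∂z_j ∂z̄_k)_{j,k}` of a smooth function, where
`∂/∂z_j = (∂/∂x_j - i ∂/∂y_j) / 2` and `∂/∂z̄_k = (∂/∂x_k + i ∂/∂y_k) / 2`. -/
def complexHessian {d : ℕ} (u : (Fin d → ℂ) → ℝ) (z : Fin d → ℂ) :
    Matrix (Fin d) (Fin d) ℂ :=
  let H : (Fin d → ℂ) → (Fin d → ℂ) → ℂ := fun a b => ((fderiv ℝ (fderiv ℝ u) z a b : ℝ) : ℂ)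
  Matrix.of fun j k =>
    (1 / 4 : ℂ) *
      ((H (Pi.single j 1) (Pi.single k 1) + H (Pi.single j Complex.I) (Pi.single k Complex.I)) +
        Complex.I *
          (H (Pi.single j 1) (Pi.single k Complex.I) - H (Pi.single j Complex.I) (Pi.single k 1)))

/-- The Lebesgue density `4^d d! det (∂²u / ∂z_j ∂z̄_k)` of `(dd^c u)^d` for smooth `u`, with the
normalization `dd^c = 2 i ∂ ∂̄` (so that `dd^c` is the Laplacian if `d = 1`). -/
def smoothMongeAmpere {d : ℕ} (u : (Fin d → ℂ) → ℝ) (z : Fin d → ℂ) : ℝ :=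
  4 ^ d * (d.factorial : ℝ) * (complexHessian u z).det.re

/-- `ν` is the complex Monge-Ampère measure `(dd^c u)^d`, in the sense of Bedford and Taylor, of
the locally bounded plurisubharmonic function `u` on `ℂ^d`: it is the locally finite measure such
that `(dd^c u_n)^d → ν` weakly for all sequences of smooth plurisubharmonic functions `u_n`
that decrease to `u`. -/
def IsMongeAmpereMeasure {d : ℕ} (u : (Fin d → ℂ) → EReal) (ν : Measure (Fin d → ℂ)) : Prop :=
  Plurisubharmonic u ∧
  (∀ z, ∃ C : ℝ, ∀ᶠ ξ in 𝓝 z, ((-C : ℝ) : EReal) ≤ u ξ ∧ u ξ ≤ (C : EReal)) ∧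
  IsLocallyFiniteMeasure ν ∧
  ∀ s : ℕ → (Fin d → ℂ) → ℝ,
    (∀ n, ContDiff ℝ (⊤ : ℕ∞) (s n) ∧ Plurisubharmonic (fun z => (s n z : EReal))) →
    (∀ z, Antitone fun n => s n z) →
    (∀ z, Tendsto (fun n => (s n z : EReal)) atTop (𝓝 (u z))) →
    ∀ χ : (Fin d → ℂ) → ℝ, Continuous χ → HasCompactSupport χ →
      Tendsto (fun n => ∫ z, χ z * smoothMongeAmpere (s n) z) atTop (𝓝 (∫ z, χ z ∂ν))

open Classical in
/-- The complex Monge-Ampère operator `u ↦ (dd^c u)^d` on locally bounded plurisubharmonic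
functions (and the zero measure for other `u`). -/
def mongeAmpere {d : ℕ} (u : (Fin d → ℂ) → EReal) : Measure (Fin d → ℂ) :=
  if h : ∃ ν, IsMongeAmpereMeasure u ν then h.choose else 0

/-- The weighted pluripotential equilibrium measure `μ_{D,Q} = (2π)^{-d} (dd^c V*_{D,Q})^d`. The
measure on the right is carried by the closed set `D ⊂ ℝ^d ⊂ ℂ^d`; here it is viewed as a
measure on `D`, that is, as a measure on `ℝ^d` that is carried by `D`. -/
def equilibriumMeasure {d : ℕ} (D : Set (Fin d → ℝ)) (Q : (Fin d → ℝ) → ℝ) :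
    Measure (Fin d → ℝ) :=
  ENNReal.ofReal (((2 * Real.pi) ^ d)⁻¹) •
    ((mongeAmpere (regExtremalFunction D Q)).comap toComplex).restrict D

/-- The Lebesgue density `v_{D,Q} = dμ_{D,Q}/dz`. -/
def equilibriumDensity {d : ℕ} (D : Set (Fin d → ℝ)) (Q : (Fin d → ℝ) → ℝ)
    (z : Fin d → ℝ) : ℝ :=
  ((equilibriumMeasure D Q).rnDeriv volume z).toReal

/-! ### The weight, the polynomial space, and `L²` quantities -/

/-- Admissible unbounded pairs: `D` is a closed unbounded cone of positive Lebesgue measure and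
`Q` is `t`-homogeneous on `D` and grows at least linearly at infinity; the weight is
`w = exp (-2 Q)`. -/
structure UnboundedAdmissible {d : ℕ} (D : Set (Fin d → ℝ)) (Q : (Fin d → ℝ) → ℝ) (t : ℝ) :
    Prop where
  isClosed : IsClosed D
  unbounded : ¬ Bornology.IsBounded D
  conic : ∀ z ∈ D, ∀ c : ℝ, 0 ≤ c → c • z ∈ D
  volume_ne_zero : volume D ≠ 0
  measurable : Measurable (D.domRestrict Q)
  growth : ∃ a > (0 : ℝ), ∃ ρ : ℝ, ∀ z ∈ D,
    ρ ≤ Real.sqrt (∑ i, z i ^ 2) → a * Real.sqrt (∑ i, z i ^ 2) ≤ Q z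
  one_le : 1 ≤ t
  homogeneous : ∀ z ∈ D, ∀ c : ℝ, 0 < c → Q (c • z) = c ^ t * Q z

/-- The weight `w = exp (-2 Q)`. -/
def weight {d : ℕ} (Q : (Fin d → ℝ) → ℝ) (z : Fin d → ℝ) : ℝ := Real.exp (-2 * Q z)

/-- The measure `ω(z) dz` on `D`. -/
def weightMeasure {d : ℕ} (D : Set (Fin d → ℝ)) (ω : (Fin d → ℝ) → ℝ) :
    Measure (Fin d → ℝ) :=
  (volume.restrict D).withDensity fun z => ENNReal.ofReal (ω z)

/-- The squared `L²(μ)` norm, with values in `[0, ∞]`. -/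
def sqNorm {d : ℕ} (μ : Measure (Fin d → ℝ)) (g : (Fin d → ℝ) → ℝ) : ℝ≥0∞ :=
  ∫⁻ z, ENNReal.ofReal (g z ^ 2) ∂μ

/-- `φ` is a family of polynomials, indexed by the multi-indices, with `deg φ_α = |α|` that is
orthonormal in `L²_w(D)`. -/
def IsOrthonormalFamily {d : ℕ} (D : Set (Fin d → ℝ)) (w : (Fin d → ℝ) → ℝ)
    (φ : (Fin d → ℕ) → MvPolynomial (Fin d) ℝ) : Prop :=
  (∀ α, (φ α).totalDegree = ∑ i, α i) ∧
    ∀ α β, ∫ z in D, MvPolynomial.eval z (φ α) * MvPolynomial.eval z (φ β) * w z =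
      if α = β then 1 else 0

/-- The polynomial space `P = span {φ_α | α ∈ Λ}`. -/
def polySpace {d : ℕ} (φ : (Fin d → ℕ) → MvPolynomial (Fin d) ℝ) (Λ : Finset (Fin d → ℕ)) :
    Submodule ℝ (MvPolynomial (Fin d) ℝ) :=
  Submodule.span ℝ (φ '' (Λ : Set (Fin d → ℕ)))

/-- `p` is the `L²(μ)`-orthogonal projection `argmin_{q ∈ P} ‖f - q‖_{L²(μ)}` of `f` onto `P`. -/
def IsProjection {d : ℕ} (μ : Measure (Fin d → ℝ))
    (P : Submodule ℝ (MvPolynomial (Fin d) ℝ)) (f : (Fin d → ℝ) → ℝ)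
    (p : MvPolynomial (Fin d) ℝ) : Prop :=
  p ∈ P ∧ ∀ q ∈ P, sqNorm μ (fun z => f z - MvPolynomial.eval z p) ≤
    sqNorm μ (fun z => f z - MvPolynomial.eval z q)

/-- The diagonal `K(z) = ∑_{α ∈ Λ} φ_α(z)²` of the reproducing kernel of `P`. -/
def kernelDiag {d : ℕ} (φ : (Fin d → ℕ) → MvPolynomial (Fin d) ℝ) (Λ : Finset (Fin d → ℕ))
    (z : Fin d → ℝ) : ℝ :=
  ∑ α ∈ Λ, MvPolynomial.eval z (φ α) ^ 2

/-- The normalized Christoffel function `N / K(z)`, `N = |Λ|`. -/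
def christoffelWeight {d : ℕ} (φ : (Fin d → ℕ) → MvPolynomial (Fin d) ℝ)
    (Λ : Finset (Fin d → ℕ)) (z : Fin d → ℝ) : ℝ :=
  (Λ.card : ℝ) / kernelDiag φ Λ z

/-- The maximal degree `k = max_{α ∈ Λ} |α|`. -/
def maxDegree {d : ℕ} (Λ : Finset (Fin d → ℕ)) : ℕ := Λ.sup fun α => ∑ i, α i

/-- The sampling density `v(z) = k^{-d/t} v_{D,Q}(k^{-1/t} z)`. -/
def samplingDensity {d : ℕ} (D : Set (Fin d → ℝ)) (Q : (Fin d → ℝ) → ℝ) (t : ℝ)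
    (Λ : Finset (Fin d → ℕ)) (z : Fin d → ℝ) : ℝ :=
  (maxDegree Λ : ℝ) ^ (-(d : ℝ) / t) *
    equilibriumDensity D Q ((maxDegree Λ : ℝ) ^ (-1 / t) • z)

/-- The surrogate weight `w̃ = v N / K`. -/
def surrogateWeight {d : ℕ} (D : Set (Fin d → ℝ)) (Q : (Fin d → ℝ) → ℝ) (t : ℝ)
    (φ : (Fin d → ℕ) → MvPolynomial (Fin d) ℝ) (Λ : Finset (Fin d → ℕ))
    (z : Fin d → ℝ) : ℝ :=
  samplingDensity D Q t Λ z * christoffelWeight φ Λ z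

/-- The `L²_ω(D)` Gramian of the `φ_α`, `α ∈ Λ`. -/
def gramian {d : ℕ} (D : Set (Fin d → ℝ)) (ω : (Fin d → ℝ) → ℝ)
    (φ : (Fin d → ℕ) → MvPolynomial (Fin d) ℝ) (Λ : Finset (Fin d → ℕ)) : Matrix Λ Λ ℝ :=
  Matrix.of fun α β =>
    ∫ z in D, MvPolynomial.eval z (φ α) * MvPolynomial.eval z (φ β) * ω z

theorem gramian_isHermitian {d : ℕ} (D : Set (Fin d → ℝ)) (ω : (Fin d → ℝ) → ℝ)
    (φ : (Fin d → ℕ) → MvPolynomial (Fin d) ℝ) (Λ : Finset (Fin d → ℕ)) :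
    (gramian D ω φ Λ).IsHermitian := by
  ext α β
  simp [gramian, mul_comm]

/-- The smallest eigenvalue of the `L²_ω(D)` Gramian. -/
def lambdaMin {d : ℕ} (D : Set (Fin d → ℝ)) (ω : (Fin d → ℝ) → ℝ)
    (φ : (Fin d → ℕ) → MvPolynomial (Fin d) ℝ) (Λ : Finset (Fin d → ℕ)) : ℝ :=
  ⨅ i, (gramian_isHermitian D ω φ Λ).eigenvalues i

/-- The largest eigenvalue of the `L²_ω(D)` Gramian. -/
def lambdaMax {d : ℕ} (D : Set (Fin d → ℝ)) (ω : (Fin d → ℝ) → ℝ)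
    (φ : (Fin d → ℕ) → MvPolynomial (Fin d) ℝ) (Λ : Finset (Fin d → ℕ)) : ℝ :=
  ⨆ i, (gramian_isHermitian D ω φ Λ).eigenvalues i

/-! ### The estimator -/

/-- `p` is a weighted least-squares approximation of `f` from `P` at the points `z_s`, with the
Christoffel weights `k_s = N / K(z_s)`:
`p ∈ argmin_{q ∈ P} (1/S) ∑_s k_s |f(z_s) - q(z_s)|²`. -/
def IsDiscreteLeastSquares {d S : ℕ} (φ : (Fin d → ℕ) → MvPolynomial (Fin d) ℝ)
    (Λ : Finset (Fin d → ℕ)) (z : Fin S → Fin d → ℝ) (f : (Fin d → ℝ) → ℝ)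
    (p : MvPolynomial (Fin d) ℝ) : Prop :=
  p ∈ polySpace φ Λ ∧ ∀ q ∈ polySpace φ Λ,
    (1 / (S : ℝ)) * ∑ s, christoffelWeight φ Λ (z s) * (f (z s) - MvPolynomial.eval (z s) p) ^ 2 ≤
    (1 / (S : ℝ)) * ∑ s, christoffelWeight φ Λ (z s) * (f (z s) - MvPolynomial.eval (z s) q) ^ 2

/-- The truncation `T_L(x) = sgn(x) min {|x|, L}`. -/
def truncT (L x : ℝ) : ℝ := Real.sign x * min |x| L

/-- The constant `c_δ = δ + (1 - δ) log (1 - δ)`. -/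
def cDelta (δ : ℝ) : ℝ := δ + (1 - δ) * Real.log (1 - δ)

/-- `ε(S) = (2 - 2 log 2) / ((1 + r) log S)`. -/
def epsilon (r : ℝ) (S : ℕ) : ℝ := (2 - 2 * Real.log 2) / ((1 + r) * Real.log S)

end CLS

end

open CLS

namespace CLS

/-! ### The Lie product formula and the Golden-Thompson inequality -/

/-! Since `D` is a cone, the expanded samples `z_s` lie in `D` and have density `v` there
(`map_equilibriumMeasure`). With weights `N/K`, sample averages are therefore unbiased for integrals
against `w̃`. The vectors `ξ_s = √(N/K) φ(z_s)` satisfy `|ξ_s|² ≤ N`, and `(1/S) ∑ ξ_s ξ_sᵀ` has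
mean `R`.

Write `g = f - Πf`, `l = λ_min(R)`, and let `c` be the coefficients of `Π̃^S f - Πf`. If the
empirical Gramian is at least `l/2`, the normal equations give `|c|² ≤ (4/l²)|b|²`, where `b`
averages `(N/K) g φ`. Its second moment is at most a squared bias plus a variance `(N/S) ‖g‖²_w̃`.
The bias equals `R e`, with `e` the coefficients of `Π̃f - Πf`, so it contributes `λ_max² d²(f)`.
The sample size condition turns `4N/(l² S)` into at most `ε(S)/l`. Pythagoras in `L²_w` then adds
`|c|²` to `‖g‖²_w`, and truncation does not increase the error.

The Gramian fails to be at least `l/2` with probability at most `S^{-r}`, and there truncation caps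
the squared error by `4L² ∫ w`. This is a matrix Chernoff bound
(`exists_integrable_majorant_chernoff`), proved with Golden-Thompson by removing one sample at a
time from `E tr exp(-θ ∑ ξ_s ξ_sᵀ)`.

The minimizer is an arbitrary choice in `ω`, with no measurability. Both regimes are therefore
controlled by integrable majorants `V` and `H` rather than by events. -/

theorem norm_pow_sub_pow_le {𝔸 : Type*} [NormedRing 𝔸] [NormOneClass 𝔸] {x y : 𝔸} {C : ℝ}
    (hC : 1 ≤ C) (hx : ‖x‖ ≤ C) (hy : ‖y‖ ≤ C) (m : ℕ) :
    ‖x ^ m - y ^ m‖ ≤ m * C ^ m * ‖x - y‖ := by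
  induction m with
  | zero => simp
  | succ m ih =>
    have e : x ^ (m + 1) - y ^ (m + 1) = x * (x ^ m - y ^ m) + (x - y) * y ^ m := by
      rw [pow_succ', pow_succ']; noncomm_ring
    have h1 : ‖y ^ m‖ ≤ C ^ m := (norm_pow_le y m).trans (by gcongr)
    have h2 : C ^ m ≤ C ^ (m + 1) := pow_le_pow_right₀ hC (Nat.le_succ m)
    calc ‖x ^ (m + 1) - y ^ (m + 1)‖
        ≤ ‖x‖ * ‖x ^ m - y ^ m‖ + ‖x - y‖ * ‖y ^ m‖ := by
          rw [e]
          exact (norm_add_le _ _).trans (add_le_add (norm_mul_le _ _) (norm_mul_le _ _))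
      _ ≤ C * (m * C ^ m * ‖x - y‖) + ‖x - y‖ * C ^ (m + 1) := by
          gcongr
          exact h1.trans h2
      _ = (m + 1 : ℕ) * C ^ (m + 1) * ‖x - y‖ := by push_cast; ring

theorem norm_exp_le_exp_norm {𝔸 : Type*} [NormedRing 𝔸] [NormOneClass 𝔸] [NormedAlgebra ℝ 𝔸]
    [CompleteSpace 𝔸] (x : 𝔸) : ‖NormedSpace.exp x‖ ≤ Real.exp ‖x‖ := by
  rw [NormedSpace.exp_eq_tsum ℝ, Real.exp_eq_exp_ℝ, NormedSpace.exp_eq_tsum ℝ]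
  refine tsum_of_norm_bounded (NormedSpace.expSeries_summable' (𝕂 := ℝ) ‖x‖).hasSum fun n => ?_
  rw [norm_smul, smul_eq_mul, Real.norm_of_nonneg (by positivity)]
  gcongr
  exact norm_pow_le x n

/-- At step `1/m` the two sides agree to first order, so they differ by `o(1/m)`. Taking `m`-th
powers costs only a factor `m` times a constant. -/
theorem tendsto_exp_mul_exp_pow {𝔸 : Type*} [NormedRing 𝔸] [NormOneClass 𝔸] [NormedAlgebra ℝ 𝔸]
    [CompleteSpace 𝔸] (a b : 𝔸) :
    Tendsto (fun m : ℕ => (NormedSpace.exp ((m : ℝ)⁻¹ • a) * NormedSpace.exp ((m : ℝ)⁻¹ • b)) ^ m)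
      atTop (𝓝 (NormedSpace.exp (a + b))) := by
  set F : ℝ → 𝔸 := fun h => NormedSpace.exp (h • (a + b)) -
    NormedSpace.exp (h • a) * NormedSpace.exp (h • b) with hF
  have hd : ∀ c : 𝔸, HasDerivAt (fun h : ℝ => NormedSpace.exp (h • c)) c 0 := fun c => by
    simpa using hasDerivAt_exp_smul_const (𝕂 := ℝ) c (0 : ℝ)
  have hFd : HasDerivAt F 0 0 := by
    exact ((hd (a + b)).sub ((hd a).mul (hd b))).congr_deriv (by simp)
  have hlim : Tendsto (fun m : ℕ => (m : ℝ) * ‖F (m : ℝ)⁻¹‖) atTop (𝓝 0) := by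
    have h1 := hasDerivAt_iff_tendsto_slope_zero.1 hFd
    have h2 : Tendsto (fun m : ℕ => (m : ℝ)⁻¹) atTop (𝓝[≠] 0) :=
      (tendsto_inv_atTop_nhdsGT_zero.comp tendsto_natCast_atTop_atTop).mono_right
        (nhdsWithin_mono _ fun x hx => ne_of_gt hx)
    have h3 := (h1.comp h2).norm
    have hF0 : F 0 = 0 := by simp [hF]
    simpa [Function.comp_def, norm_smul, hF0] using h3
  set M : ℝ := Real.exp (‖a‖ + ‖b‖) with hM
  have hbd : ∀ᶠ m : ℕ in atTop, ‖NormedSpace.exp (a + b) -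
      (NormedSpace.exp ((m : ℝ)⁻¹ • a) * NormedSpace.exp ((m : ℝ)⁻¹ • b)) ^ m‖ ≤
      M * ((m : ℝ) * ‖F (m : ℝ)⁻¹‖) := by
    filter_upwards [eventually_gt_atTop 0] with m hm
    have hm' : (0 : ℝ) < m := by exact_mod_cast hm
    have e1 : NormedSpace.exp (a + b) = NormedSpace.exp ((m : ℝ)⁻¹ • (a + b)) ^ m := by
      let _ : NormedAlgebra ℚ 𝔸 := NormedAlgebra.restrictScalars ℚ ℝ 𝔸
      rw [← NormedSpace.exp_nsmul, ← Nat.cast_smul_eq_nsmul ℝ, smul_smul,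
        mul_inv_cancel₀ hm'.ne', one_smul]
    -- A common bound for both bases whose `m`-th power `M` does not depend on `m`.
    set C : ℝ := Real.exp ((m : ℝ)⁻¹ * (‖a‖ + ‖b‖)) with hC
    have hCM : C ^ m = M := by
      rw [hC, ← Real.exp_nat_mul, ← mul_assoc, mul_inv_cancel₀ hm'.ne', one_mul]
    have hnorm : ∀ c : 𝔸, ‖NormedSpace.exp ((m : ℝ)⁻¹ • c)‖ ≤ Real.exp ((m : ℝ)⁻¹ * ‖c‖) :=
      fun c => (norm_exp_le_exp_norm _).trans (by
        rw [norm_smul, Real.norm_of_nonneg (by positivity)])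
    have hx : ‖NormedSpace.exp ((m : ℝ)⁻¹ • (a + b))‖ ≤ C := by
      refine (hnorm _).trans (Real.exp_le_exp.2 ?_)
      gcongr
      exact norm_add_le _ _
    have hy : ‖NormedSpace.exp ((m : ℝ)⁻¹ • a) * NormedSpace.exp ((m : ℝ)⁻¹ • b)‖ ≤ C := by
      refine (norm_mul_le _ _).trans ?_
      rw [hC, mul_add, Real.exp_add]
      exact mul_le_mul (hnorm a) (hnorm b) (norm_nonneg _) (Real.exp_nonneg _)
    have := norm_pow_sub_pow_le (Real.one_le_exp (by positivity)) hx hy m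
    rw [← e1, hCM] at this
    calc _ ≤ _ := this
      _ = _ := by simp only [hF]; ring
  rw [tendsto_iff_norm_sub_tendsto_zero]
  refine squeeze_zero' (Eventually.of_forall fun _ => norm_nonneg _) ?_
    (by simpa using hlim.const_mul M)
  filter_upwards [hbd] with m hm
  rwa [norm_sub_rev]

/-! ### Trace inequalities for real matrices, up to Golden-Thompson. -/

section Trace

open Matrix

variable {n : Type*} [Fintype n]

theorem trace_mul_pow_comm [DecidableEq n] (A B : Matrix n n ℝ) (m : ℕ) :
    ((A * B) ^ m).trace = ((B * A) ^ m).trace := by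
  cases m with
  | zero => simp
  | succ m =>
    have h : ∀ j : ℕ, (A * B) ^ j * A = A * (B * A) ^ j := by
      intro j
      induction j with
      | zero => simp
      | succ j ih => rw [pow_succ, mul_assoc, mul_assoc A B A, ← mul_assoc, ih, mul_assoc, ← pow_succ]
    rw [pow_succ, ← mul_assoc, h, Matrix.trace_mul_comm, ← mul_assoc, ← pow_succ']

theorem trace_mul_transpose_eq_sum (A B : Matrix n n ℝ) :
    (A * Bᵀ).trace = ∑ x : n × n, A x.1 x.2 * B x.1 x.2 := by
  rw [Fintype.sum_prod_type]
  simp [Matrix.trace, Matrix.mul_apply]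

theorem trace_mul_transpose_sq_le (A B : Matrix n n ℝ) :
    (A * Bᵀ).trace ^ 2 ≤ (A * Aᵀ).trace * (B * Bᵀ).trace := by
  simp only [trace_mul_transpose_eq_sum]
  simpa [pow_two] using Finset.sum_mul_sq_le_sq_mul_sq Finset.univ
    (fun x : n × n => A x.1 x.2) (fun x => B x.1 x.2)

theorem trace_mul_transpose_self_nonneg (A : Matrix n n ℝ) : 0 ≤ (A * Aᵀ).trace := by
  rw [trace_mul_transpose_eq_sum]
  exact Finset.sum_nonneg fun x _ => mul_self_nonneg _

theorem trace_mul_transpose_le {A B : Matrix n n ℝ} {c : ℝ}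
    (hA : (A * Aᵀ).trace = c) (hB : (B * Bᵀ).trace = c) : (A * Bᵀ).trace ≤ c := by
  have h := trace_mul_transpose_sq_le A B
  have h0 := trace_mul_transpose_self_nonneg A
  rw [hA, hB] at h
  rw [hA] at h0
  exact (abs_le_of_sq_le_sq' (by linarith) h0).2

variable [DecidableEq n]

/-- The two claims feed each other in one induction. The second, applied to `A * B`, turns
`(AB)^(2^(k+1))` into `(A²B²)^(2^k)` under the trace, to which the first applies. The first, applied
to `XᵀX` and `XXᵀ`, gives the next case of the second after Cauchy-Schwarz. -/
theorem trace_pow_two_pow_le (k : ℕ) :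
    (∀ A B : Matrix n n ℝ, A.IsSymm → B.IsSymm →
      ((A * B) ^ 2 ^ k).trace ≤ (A ^ 2 ^ k * B ^ 2 ^ k).trace) ∧
    ∀ X : Matrix n n ℝ, (X ^ 2 ^ (k + 1)).trace ≤ ((X * Xᵀ) ^ 2 ^ k).trace := by
  induction k with
  | zero =>
    refine ⟨fun A B _ _ => by simp, fun X => ?_⟩
    have := trace_mul_transpose_le (A := X) (B := Xᵀ) rfl
      (by rw [transpose_transpose, Matrix.trace_mul_comm])
    simpa [pow_two] using this
  | succ k ih =>
    have hQ : ∀ A B : Matrix n n ℝ, A.IsSymm → B.IsSymm →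
        ((A * B) ^ 2 ^ (k + 1)).trace ≤ (A ^ 2 ^ (k + 1) * B ^ 2 ^ (k + 1)).trace := by
      intro A B hA hB
      refine (ih.2 (A * B)).trans ?_
      have e : ((A * B * (A * B)ᵀ) ^ 2 ^ k).trace = ((A ^ 2 * B ^ 2) ^ 2 ^ k).trace := by
        rw [transpose_mul, hA.eq, hB.eq, ← mul_assoc, trace_mul_pow_comm]
        congr 2
        noncomm_ring
      rw [e]
      refine (ih.1 _ _ (hA.pow 2) (hB.pow 2)).trans (le_of_eq ?_)
      rw [← pow_mul, ← pow_mul, ← pow_succ']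
    refine ⟨hQ, fun X => ?_⟩
    have e1 : X ^ 2 ^ (k + 1 + 1) = (X ^ 2) ^ 2 ^ (k + 1) := by rw [← pow_mul, ← pow_succ']
    rw [e1]
    refine (ih.2 (X ^ 2)).trans ?_
    have e2 : ((X ^ 2 * (X ^ 2)ᵀ) ^ 2 ^ k).trace = ((Xᵀ * X * (X * Xᵀ)) ^ 2 ^ k).trace := by
      have e : X ^ 2 * (X ^ 2)ᵀ = X * (X * Xᵀ) * Xᵀ := by
        simp only [transpose_mul, pow_two, mul_assoc]
      rw [e, mul_assoc Xᵀ X, ← trace_mul_pow_comm]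
    rw [e2]
    have hs1 : (Xᵀ * X).IsSymm := by simp [Matrix.IsSymm]
    have hs2 : (X * Xᵀ).IsSymm := by simp [Matrix.IsSymm]
    refine (ih.1 _ _ hs1 hs2).trans ?_
    -- Cyclicity of the trace gives both factors the same Frobenius norm, so Cauchy-Schwarz closes
    -- up with no loss.
    have h := trace_mul_transpose_le (A := (Xᵀ * X) ^ 2 ^ k) (B := (X * Xᵀ) ^ 2 ^ k)
      (c := ((X * Xᵀ) ^ 2 ^ (k + 1)).trace)
      (by rw [(hs1.pow _).eq, ← pow_add, ← two_mul, ← pow_succ', trace_mul_pow_comm])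
      (by rw [(hs2.pow _).eq, ← pow_add, ← two_mul, ← pow_succ'])
    rwa [(hs2.pow _).eq] at h

open scoped Matrix.Norms.Operator in
-- Golden-Thompson: along `m = 2^k` the Lie product formula converges to the left side, while every
-- term is already bounded by the right side.
theorem trace_exp_add_le {A B : Matrix n n ℝ} (hA : A.IsSymm) (hB : B.IsSymm) :
    (NormedSpace.exp (A + B)).trace ≤ (NormedSpace.exp A * NormedSpace.exp B).trace := by
  rcases isEmpty_or_nonempty n with hn | hn
  · simp [Matrix.trace]
  have ht : Tendsto (fun k : ℕ => 2 ^ k) atTop atTop := tendsto_pow_atTop_atTop_of_one_lt one_lt_two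
  have h := (tendsto_exp_mul_exp_pow A B).comp ht
  have hc : Continuous fun M : Matrix n n ℝ => M.trace := by fun_prop
  refine le_of_tendsto ((hc.tendsto _).comp h) (Eventually.of_forall fun k => ?_)
  have hsc : ∀ (C : Matrix n n ℝ), C.IsSymm →
      (NormedSpace.exp (((2 ^ k : ℕ) : ℝ)⁻¹ • C)).IsSymm := fun C hC => (hC.smul _).exp
  have hpow : ∀ C : Matrix n n ℝ,
      NormedSpace.exp (((2 ^ k : ℕ) : ℝ)⁻¹ • C) ^ 2 ^ k = NormedSpace.exp C := by
    intro C
    rw [← Matrix.exp_nsmul, ← Nat.cast_smul_eq_nsmul ℝ, smul_smul,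
      mul_inv_cancel₀ (by positivity), one_smul]
  have := (trace_pow_two_pow_le k).1 _ _ (hsc A hA) (hsc B hB)
  rw [hpow, hpow] at this
  exact this

end Trace

/-! ### Spectral estimates for real symmetric matrices -/

section Spectral

open Matrix

theorem isSymm_vecMulVec_self {n : Type*} (x : n → ℝ) : (vecMulVec x x).IsSymm :=
  transpose_vecMulVec x x

variable {n : Type*} [Fintype n]

variable [DecidableEq n]

theorem exists_orthogonal_diagonalization {A : Matrix n n ℝ} (hA : A.IsHermitian) :
    ∃ U : Matrix n n ℝ, U * Uᵀ = 1 ∧ Uᵀ * U = 1 ∧ A = U * diagonal hA.eigenvalues * Uᵀ := by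
  refine ⟨hA.eigenvectorUnitary, ?_, ?_, ?_⟩
  · simpa [star_eq_conjTranspose] using (Matrix.mem_unitaryGroup_iff).1 hA.eigenvectorUnitary.2
  · simpa [star_eq_conjTranspose] using (Matrix.mem_unitaryGroup_iff').1 hA.eigenvectorUnitary.2
  · have h := hA.spectral_theorem
    rw [Unitary.conjStarAlgAut_apply] at h
    simpa [star_eq_conjTranspose, Function.comp_def] using h

theorem dotProduct_mulVec_diagonalization (U : Matrix n n ℝ) (e x : n → ℝ) :
    x ⬝ᵥ (U * diagonal e * Uᵀ) *ᵥ x = ∑ i, e i * (Uᵀ *ᵥ x) i ^ 2 := by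
  rw [← mulVec_mulVec, ← mulVec_mulVec, dotProduct_mulVec, ← mulVec_transpose, dotProduct]
  refine Finset.sum_congr rfl fun i _ => ?_
  rw [mulVec_diagonal]
  ring

theorem dotProduct_self_of_orthogonal {U : Matrix n n ℝ} (hU : U * Uᵀ = 1) (x : n → ℝ) :
    x ⬝ᵥ x = ∑ i, (Uᵀ *ᵥ x) i ^ 2 := by
  have h := dotProduct_mulVec_diagonalization U (fun _ => 1) x
  simpa [hU] using h

theorem iInf_eigenvalues_mul_le {A : Matrix n n ℝ} (hA : A.IsHermitian) (x : n → ℝ) :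
    (⨅ i, hA.eigenvalues i) * (x ⬝ᵥ x) ≤ x ⬝ᵥ A *ᵥ x := by
  obtain ⟨U, hU, -, h⟩ := exists_orthogonal_diagonalization hA
  generalize hA.eigenvalues = e at *
  subst h
  rw [dotProduct_mulVec_diagonalization, dotProduct_self_of_orthogonal hU, Finset.mul_sum]
  gcongr with i
  exact ciInf_le (Set.finite_range _).bddBelow i

theorem dotProduct_mulVec_self_le {A : Matrix n n ℝ} (hA : A.IsHermitian)
    (h0 : ∀ x : n → ℝ, 0 ≤ x ⬝ᵥ A *ᵥ x) (x : n → ℝ) :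
    (A *ᵥ x) ⬝ᵥ (A *ᵥ x) ≤ (⨆ i, hA.eigenvalues i) ^ 2 * (x ⬝ᵥ x) := by
  have he : ∀ i, 0 ≤ hA.eigenvalues i := fun i => by
    rw [hA.eigenvalues_eq i]
    simpa using h0 _
  obtain ⟨U, hU, hU', h⟩ := exists_orthogonal_diagonalization hA
  have h2 : A * A = U * diagonal (fun i => hA.eigenvalues i ^ 2) * Uᵀ := by
    generalize hA.eigenvalues = e at *
    subst h
    calc _ = U * diagonal e * (Uᵀ * U) * diagonal e * Uᵀ := by simp only [mul_assoc]
      _ = U * (diagonal e * diagonal e) * Uᵀ := by rw [hU']; simp only [mul_assoc, one_mul]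
      _ = _ := by rw [diagonal_mul_diagonal]; simp only [pow_two]
  have ht : Aᵀ = A := (conjTranspose_eq_transpose_of_trivial A).symm.trans hA
  have h3 : (A *ᵥ x) ⬝ᵥ (A *ᵥ x) = x ⬝ᵥ (A * A) *ᵥ x := by
    rw [← mulVec_mulVec, dotProduct_mulVec x, ← mulVec_transpose, ht]
  rw [h3, h2, dotProduct_mulVec_diagonalization, dotProduct_self_of_orthogonal hU, Finset.mul_sum]
  gcongr with i
  · exact he i
  · exact le_ciSup (Set.finite_range _).bddAbove i

/-- A Rayleigh quotient below `τ` forces an eigenvalue below `τ`, and its exponential alone is at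
most the trace. This is the Laplace transform step of the Chernoff bound. -/
theorem exp_neg_le_trace_exp {A : Matrix n n ℝ} (hA : A.IsSymm) {τ θ : ℝ} (hθ : 0 ≤ θ)
    {x : n → ℝ} (hx : x ⬝ᵥ A *ᵥ x < τ * (x ⬝ᵥ x)) :
    Real.exp (-(θ * τ)) ≤ (NormedSpace.exp (-θ • A)).trace := by
  have hA' : A.IsHermitian := (conjTranspose_eq_transpose_of_trivial A).trans hA
  obtain ⟨U, hU, hU', h⟩ := exists_orthogonal_diagonalization hA'
  generalize hA'.eigenvalues = e at *
  subst h
  have hinv : U⁻¹ = Uᵀ := Matrix.inv_eq_right_inv hU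
  have hunit : IsUnit U := IsUnit.of_mul_eq_one _ hU
  have hexp : (NormedSpace.exp (-θ • (U * diagonal e * Uᵀ))).trace =
      ∑ i, Real.exp (-(θ * e i)) := by
    rw [← hinv, ← smul_mul_assoc, ← mul_smul_comm, Matrix.exp_conj _ _ hunit, hinv,
      Matrix.trace_mul_cycle, hU', one_mul, ← diagonal_smul, exp_diagonal, trace_diagonal]
    refine Finset.sum_congr rfl fun i _ => ?_
    rw [Pi.exp_def]
    simp [Real.exp_eq_exp_ℝ]
  rw [hexp]
  rw [dotProduct_mulVec_diagonalization, dotProduct_self_of_orthogonal hU, Finset.mul_sum] at hx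
  obtain ⟨i, -, hi⟩ := Finset.exists_lt_of_sum_lt hx
  have hi' : e i < τ := lt_of_mul_lt_mul_right hi (sq_nonneg _)
  refine le_trans ?_ (Finset.single_le_sum (f := fun i => Real.exp (-(θ * e i)))
    (fun i _ => (Real.exp_pos _).le) (Finset.mem_univ i))
  apply Real.exp_le_exp.2
  nlinarith

/-- The factor is `exp(A/2)`; this is the form in which positivity of `exp A` is used below. -/
theorem exists_exp_eq_mul_transpose {A : Matrix n n ℝ} (hA : A.IsSymm) :
    ∃ E : Matrix n n ℝ, NormedSpace.exp A = E * Eᵀ := by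
  refine ⟨NormedSpace.exp ((2 : ℝ)⁻¹ • A), ?_⟩
  rw [((hA.smul (2 : ℝ)⁻¹).exp).eq, ← Matrix.exp_add_of_commute _ _ (Commute.refl _),
    ← two_smul ℝ, smul_smul]
  norm_num

theorem mul_trace_exp_le_trace_exp_mul {A R : Matrix n n ℝ} (hA : A.IsSymm) {l : ℝ}
    (hR : ∀ x : n → ℝ, l * (x ⬝ᵥ x) ≤ x ⬝ᵥ R *ᵥ x) :
    l * (NormedSpace.exp A).trace ≤ (NormedSpace.exp A * R).trace := by
  obtain ⟨E, hE⟩ := exists_exp_eq_mul_transpose hA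
  have h1 : (E * Eᵀ).trace = ∑ i, (Eᵀ i) ⬝ᵥ (Eᵀ i) := by
    rw [Matrix.trace_mul_comm]
    simp [Matrix.trace, Matrix.mul_apply, dotProduct]
  have h2 : (E * Eᵀ * R).trace = ∑ i, (Eᵀ i) ⬝ᵥ R *ᵥ (Eᵀ i) := by
    rw [mul_assoc, Matrix.trace_mul_comm, mul_assoc]
    simp only [Matrix.trace, Matrix.diag, dotProduct, mulVec, Matrix.mul_apply,
      transpose_apply]
  rw [hE, h1, h2, Finset.mul_sum]
  exact Finset.sum_le_sum fun i _ => hR _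

theorem trace_exp_nonneg {A : Matrix n n ℝ} (hA : A.IsSymm) : 0 ≤ (NormedSpace.exp A).trace := by
  obtain ⟨E, hE⟩ := exists_exp_eq_mul_transpose hA
  rw [hE]
  exact trace_mul_transpose_self_nonneg E

open scoped Matrix.Norms.Operator in
theorem exp_smul_of_isIdempotentElem {P : Matrix n n ℝ} (hP : IsIdempotentElem P) (u : ℝ) :
    NormedSpace.exp (u • P) = 1 + (Real.exp u - 1) • P := by
  have h1 : HasSum (fun k : ℕ => ((k.factorial : ℝ)⁻¹ * u ^ k) • P) (Real.exp u • P) := by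
    have := NormedSpace.exp_series_hasSum_exp' (𝕂 := ℝ) u
    rw [← Real.exp_eq_exp_ℝ] at this
    exact this.smul_const P
  -- All powers of `P` equal `P` except the zeroth, which is `1`; this series corrects that single
  -- term.
  have h2 : HasSum (fun k : ℕ => if k = 0 then (1 - P) else 0) (1 - P) := hasSum_ite_eq 0 (1 - P)
  have h3 := NormedSpace.exp_series_hasSum_exp' (𝕂 := ℝ) (u • P)
  have h4 := h1.add h2
  rw [show 1 + (Real.exp u - 1) • P = Real.exp u • P + (1 - P) by rw [sub_smul, one_smul]; abel]
  refine h3.unique (h4.congr_fun fun k => ?_)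
  rcases Nat.eq_zero_or_pos k with rfl | hk
  · simp
  · simp [smul_pow, hP.pow_eq hk.ne', smul_smul, hk.ne']

/-- `exp(-θ x xᵀ)` is the identity plus an explicit multiple of `x xᵀ`. Convexity of the exponential
replaces the coefficient depending on `|x|²` by the one for `B`, and pairing with the positive
matrix `exp A` keeps the inequality. -/
theorem trace_exp_mul_exp_neg_rankOne_le {A : Matrix n n ℝ} (hA : A.IsSymm) {x : n → ℝ} {B θ : ℝ}
    (hB : 0 < B) (hx : x ⬝ᵥ x ≤ B) :
    (NormedSpace.exp A * NormedSpace.exp (-θ • vecMulVec x x)).trace ≤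
      (NormedSpace.exp A).trace - (1 - Real.exp (-θ * B)) / B *
        (NormedSpace.exp A * vecMulVec x x).trace := by
  rcases eq_or_ne x 0 with rfl | hx0
  · simp
  set s := x ⬝ᵥ x with hs
  have hs0 : 0 < s := lt_of_le_of_ne (dotProduct_self_star_nonneg x |>.trans_eq (by simp [hs]))
    (fun h => hx0 (dotProduct_self_eq_zero.1 h.symm))
  have hP : IsIdempotentElem (s⁻¹ • vecMulVec x x) := by
    rw [IsIdempotentElem, smul_mul_smul_comm, vecMulVec_mul_vecMulVec, ← hs, vecMulVec_smul,
      smul_smul]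
    congr 1
    field_simp
  have hexp : NormedSpace.exp (-θ • vecMulVec x x) =
      1 + ((Real.exp (-θ * s) - 1) / s) • vecMulVec x x := by
    have h := exp_smul_of_isIdempotentElem hP (-θ * s)
    rwa [smul_smul, smul_smul, mul_assoc, mul_inv_cancel₀ hs0.ne', mul_one] at h
  have hq : 0 ≤ (NormedSpace.exp A * vecMulVec x x).trace := by
    have := mul_trace_exp_le_trace_exp_mul (l := 0) (R := vecMulVec x x) hA (fun y => by
      rw [vecMulVec_mulVec, zero_mul]
      simp only [op_smul_eq_smul, dotProduct_smul, smul_eq_mul]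
      rw [dotProduct_comm]
      exact mul_self_nonneg _)
    simpa using this
  -- The graph of `exp` lies below its chord between `-θB` and `0`.
  have hconv : Real.exp (-θ * s) ≤ 1 - s / B * (1 - Real.exp (-θ * B)) := by
    have h := convexOn_exp.2 (Set.mem_univ (-θ * B)) (Set.mem_univ 0)
      (show 0 ≤ s / B by positivity) (show 0 ≤ 1 - s / B by rw [sub_nonneg, div_le_one hB]; exact hx)
      (by ring)
    simp only [smul_eq_mul, mul_zero, add_zero, Real.exp_zero, mul_one] at h
    rw [show s / B * (-θ * B) = -θ * s by field_simp] at h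
    linarith
  rw [hexp, mul_add, mul_one, mul_smul_comm, trace_add, trace_smul, smul_eq_mul, sub_eq_add_neg
    (NormedSpace.exp A).trace, ← neg_mul]
  gcongr
  rw [← neg_div, div_le_div_iff₀ hs0 hB]
  have : s / B * (1 - Real.exp (-θ * B)) * B = s * (1 - Real.exp (-θ * B)) := by field_simp
  nlinarith

end Spectral

/-! ### The matrix Chernoff bound for sums of rank-one matrices -/

section Chernoff

open Matrix

variable {n ι Ω : Type*} [MeasurableSpace Ω] {Pr : Measure Ω}

theorem integrable_comp_of_bounded [IsFiniteMeasure Pr] {E : Type*} [NormedAddCommGroup E]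
    [ProperSpace E] [MeasurableSpace E] [BorelSpace E] {X : Ω → E} (hX : AEMeasurable X Pr)
    {C : ℝ} (hC : ∀ ω, ‖X ω‖ ≤ C) {F : E → ℝ} (hF : Continuous F) :
    Integrable (fun ω => F (X ω)) Pr := by
  obtain ⟨M, hM⟩ := (isCompact_closedBall (0 : E) C).exists_bound_of_continuousOn hF.continuousOn
  exact Integrable.of_bound (hF.measurable.comp_aemeasurable hX).aestronglyMeasurable M
    (Eventually.of_forall fun ω => hM _ (by simpa using hC ω))

theorem isSymm_smul_sum_vecMulVec (T : Finset ι) (θ : ℝ) (x : ι → n → ℝ) :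
    (θ • ∑ s ∈ T, vecMulVec (x s) (x s)).IsSymm := by
  refine IsSymm.smul ?_ θ
  rw [IsSymm, transpose_sum]
  exact Finset.sum_congr rfl fun s _ => transpose_vecMulVec _ _

variable [Fintype n]

theorem norm_le_of_dotProduct_self_le {x : n → ℝ} {B : ℝ} (h : x ⬝ᵥ x ≤ B) : ‖x‖ ≤ √B := by
  refine (pi_norm_le_iff_of_nonneg (Real.sqrt_nonneg _)).2 fun i => Real.abs_le_sqrt ?_
  refine le_trans ?_ h
  rw [pow_two]
  exact Finset.single_le_sum (f := fun i => x i * x i) (fun j _ => mul_self_nonneg _)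
    (Finset.mem_univ i)

variable [DecidableEq n] [DecidableEq ι]

open scoped Matrix.Norms.Operator in
theorem continuous_matrix_exp : Continuous (NormedSpace.exp : Matrix n n ℝ → Matrix n n ℝ) :=
  NormedSpace.exp_continuous

/-- Golden-Thompson splits off the new sample and the rank-one bound makes the estimate linear in
`x_j x_jᵀ`. Independence then replaces that matrix by its mean `R`, which is at least `l`. -/
theorem integral_trace_exp_insert_le [IsProbabilityMeasure Pr] {x : ι → Ω → n → ℝ}
    (hx : ∀ s, AEMeasurable (x s) Pr) (hind : iIndepFun x Pr) {B : ℝ} (hB : 0 < B)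
    (hxB : ∀ s ω, x s ω ⬝ᵥ x s ω ≤ B) {R : Matrix n n ℝ}
    (hR : ∀ s i j, ∫ ω, x s ω i * x s ω j ∂Pr = R i j) {l : ℝ}
    (hl : ∀ c : n → ℝ, l * (c ⬝ᵥ c) ≤ c ⬝ᵥ R *ᵥ c) {θ : ℝ} (hθ : 0 ≤ θ)
    {T : Finset ι} {j : ι} (hj : j ∉ T) :
    ∫ ω, (NormedSpace.exp (-θ • ∑ s ∈ insert j T, vecMulVec (x s ω) (x s ω))).trace ∂Pr ≤
      (1 - (1 - Real.exp (-θ * B)) / B * l) *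
        ∫ ω, (NormedSpace.exp (-θ • ∑ s ∈ T, vecMulVec (x s ω) (x s ω))).trace ∂Pr := by
  set g := (1 - Real.exp (-θ * B)) / B with hg
  have hg0 : 0 ≤ g := div_nonneg (sub_nonneg.2 (Real.exp_le_one_iff.2 (by nlinarith))) hB.le
  have hexpT : ∀ T : Finset ι, Continuous fun u : T → n → ℝ =>
      NormedSpace.exp (-θ • ∑ s : T, vecMulVec (u s) (u s)) := fun T =>
    continuous_matrix_exp.comp (by fun_prop)
  have hsub : ∀ (T : Finset ι) ω, ∑ s ∈ T, vecMulVec (x s ω) (x s ω) =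
      ∑ s : T, vecMulVec (x s ω) (x s ω) := fun T ω => (Finset.sum_coe_sort T _).symm
  have hmeasT : ∀ T : Finset ι, AEMeasurable (fun ω (s : T) => x s ω) Pr := fun T =>
    aemeasurable_pi_lambda _ fun s => hx s
  have hbdT : ∀ (T : Finset ι) ω, ‖fun s : T => x s ω‖ ≤ √B := fun T ω =>
    (pi_norm_le_iff_of_nonneg (Real.sqrt_nonneg _)).2 fun s =>
      norm_le_of_dotProduct_self_le (hxB s ω)
  have hint : ∀ (T : Finset ι) (F : Matrix n n ℝ → ℝ), Continuous F → Integrable (fun ω =>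
      F (NormedSpace.exp (-θ • ∑ s ∈ T, vecMulVec (x s ω) (x s ω)))) Pr := by
    intro T F hF
    simp only [hsub]
    exact integrable_comp_of_bounded (hmeasT T) (hbdT T) (hF.comp (hexpT T))
  have hentry : ∀ a b : n, Continuous fun M : Matrix n n ℝ => M a b := fun a b => by fun_prop
  -- Independence factorizes scalar integrals, so the trace is expanded into entries. The
  -- exponential involves only samples in `T`, and `j ∉ T`.
  have hprod : ∀ a b : n,
      Integrable (fun ω => NormedSpace.exp (-θ • ∑ s ∈ T, vecMulVec (x s ω) (x s ω)) a b *
        (x j ω b * x j ω a)) Pr ∧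
      ∫ ω, NormedSpace.exp (-θ • ∑ s ∈ T, vecMulVec (x s ω) (x s ω)) a b *
        (x j ω b * x j ω a) ∂Pr =
      (∫ ω, NormedSpace.exp (-θ • ∑ s ∈ T, vecMulVec (x s ω) (x s ω)) a b ∂Pr) * R b a := by
    intro a b
    have hi := hind.indepFun_finset₀ T {j} (by simpa using hj) hx
    have hi' := hi.comp (φ := fun u : T → n → ℝ => NormedSpace.exp (-θ • ∑ s : T, vecMulVec (u s) (u s)) a b)
      (ψ := fun v : ({j} : Finset ι) → n → ℝ =>
        v ⟨j, Finset.mem_singleton_self j⟩ b * v ⟨j, Finset.mem_singleton_self j⟩ a)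
      ((hentry a b).comp (hexpT T)).measurable (by fun_prop)
    have h1 := hint T _ (hentry a b)
    have h2 : Integrable (fun ω => x j ω b * x j ω a) Pr :=
      integrable_comp_of_bounded (hx j) (fun ω => norm_le_of_dotProduct_self_le (hxB j ω))
        (F := fun v => v b * v a) (by fun_prop)
    simp only [Function.comp_def, ← hsub] at hi'
    refine ⟨hi'.integrable_mul h1 h2, ?_⟩
    rw [← hR j b a]
    exact hi'.integral_fun_mul_eq_mul_integral h1.1 h2.1
  have htr : ∀ (M : Matrix n n ℝ) (v : n → ℝ),
      (M * vecMulVec v v).trace = ∑ a, ∑ b, M a b * (v b * v a) := fun M v => by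
    simp [Matrix.trace, Matrix.mul_apply, vecMulVec_apply]
  have htrR : ∀ (M : Matrix n n ℝ), (M * R).trace = ∑ a, ∑ b, M a b * R b a := fun M => by
    simp [Matrix.trace, Matrix.mul_apply]
  have hmix_int : Integrable (fun ω => (NormedSpace.exp
      (-θ • ∑ s ∈ T, vecMulVec (x s ω) (x s ω)) * vecMulVec (x j ω) (x j ω)).trace) Pr := by
    simp only [htr]
    exact integrable_finsetSum _ fun a _ => integrable_finsetSum _ fun b _ => (hprod a b).1
  have hmix : ∫ ω, (NormedSpace.exp (-θ • ∑ s ∈ T, vecMulVec (x s ω) (x s ω)) *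
        vecMulVec (x j ω) (x j ω)).trace ∂Pr =
      ∫ ω, (NormedSpace.exp (-θ • ∑ s ∈ T, vecMulVec (x s ω) (x s ω)) * R).trace ∂Pr := by
    simp only [htr, htrR]
    rw [integral_finsetSum _ fun a _ => integrable_finsetSum _ fun b _ => (hprod a b).1,
      integral_finsetSum _ fun a _ => integrable_finsetSum _ fun b _ =>
        (hint T _ (hentry a b)).mul_const _]
    refine Finset.sum_congr rfl fun a _ => ?_
    rw [integral_finsetSum _ fun b _ => (hprod a b).1,
      integral_finsetSum _ fun b _ => (hint T _ (hentry a b)).mul_const _]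
    exact Finset.sum_congr rfl fun b _ => by rw [(hprod a b).2, integral_mul_const]
  have htc : Continuous fun M : Matrix n n ℝ => M.trace := by fun_prop
  have hlow : l * ∫ ω, (NormedSpace.exp (-θ • ∑ s ∈ T, vecMulVec (x s ω) (x s ω))).trace ∂Pr ≤
      ∫ ω, (NormedSpace.exp (-θ • ∑ s ∈ T, vecMulVec (x s ω) (x s ω)) * R).trace ∂Pr := by
    rw [← integral_const_mul]
    refine integral_mono ((hint T _ htc).const_mul l)
      (hint T (fun M => (M * R).trace) (by fun_prop)) fun ω => ?_
    exact mul_trace_exp_le_trace_exp_mul (isSymm_smul_sum_vecMulVec T _ _) hl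
  calc ∫ ω, (NormedSpace.exp (-θ • ∑ s ∈ insert j T, vecMulVec (x s ω) (x s ω))).trace ∂Pr
      ≤ ∫ ω, ((NormedSpace.exp (-θ • ∑ s ∈ T, vecMulVec (x s ω) (x s ω))).trace -
        g * (NormedSpace.exp (-θ • ∑ s ∈ T, vecMulVec (x s ω) (x s ω)) *
          vecMulVec (x j ω) (x j ω)).trace) ∂Pr := by
        refine integral_mono (hint _ _ htc) ((hint T _ htc).sub (hmix_int.const_mul g)) fun ω => ?_
        have hA := isSymm_smul_sum_vecMulVec T (-θ) fun s => x s ω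
        simp only [Finset.sum_insert hj]
        rw [add_comm, smul_add]
        exact (trace_exp_add_le hA ((isSymm_vecMulVec_self (x j ω)).smul (-θ))).trans
          (trace_exp_mul_exp_neg_rankOne_le hA hB (hxB j ω))
    _ = (∫ ω, (NormedSpace.exp (-θ • ∑ s ∈ T, vecMulVec (x s ω) (x s ω))).trace ∂Pr) -
        g * ∫ ω, (NormedSpace.exp (-θ • ∑ s ∈ T, vecMulVec (x s ω) (x s ω)) * R).trace ∂Pr := by
        rw [integral_sub (hint T _ htc) (hmix_int.const_mul g), integral_const_mul, hmix]
    _ ≤ _ := by nlinarith [mul_le_mul_of_nonneg_left hlow hg0]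

theorem integral_trace_exp_le [IsProbabilityMeasure Pr] {x : ι → Ω → n → ℝ}
    (hx : ∀ s, AEMeasurable (x s) Pr) (hind : iIndepFun x Pr) {B : ℝ} (hB : 0 < B)
    (hxB : ∀ s ω, x s ω ⬝ᵥ x s ω ≤ B) {R : Matrix n n ℝ}
    (hR : ∀ s i j, ∫ ω, x s ω i * x s ω j ∂Pr = R i j) {l : ℝ}
    (hl : ∀ c : n → ℝ, l * (c ⬝ᵥ c) ≤ c ⬝ᵥ R *ᵥ c) {θ : ℝ} (hθ : 0 ≤ θ) (T : Finset ι) :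
    ∫ ω, (NormedSpace.exp (-θ • ∑ s ∈ T, vecMulVec (x s ω) (x s ω))).trace ∂Pr ≤
      Fintype.card n * Real.exp (-((1 - Real.exp (-θ * B)) / B * l)) ^ T.card := by
  induction T using Finset.induction_on with
  | empty => simp
  | insert j T hj ih =>
    have h0 : 0 ≤ ∫ ω, (NormedSpace.exp (-θ • ∑ s ∈ T, vecMulVec (x s ω) (x s ω))).trace ∂Pr :=
      integral_nonneg fun ω => trace_exp_nonneg (isSymm_smul_sum_vecMulVec T _ _)
    calc _ ≤ _ := integral_trace_exp_insert_le hx hind hB hxB hR hl hθ hj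
      _ ≤ Real.exp (-((1 - Real.exp (-θ * B)) / B * l)) *
          (Fintype.card n * Real.exp (-((1 - Real.exp (-θ * B)) / B * l)) ^ T.card) := by
        refine mul_le_mul ?_ ih h0 (Real.exp_nonneg _)
        linarith [Real.add_one_le_exp (-((1 - Real.exp (-θ * B)) / B * l))]
      _ = _ := by rw [Finset.card_insert_of_notMem hj]; ring

/-- A matrix Chernoff bound: an integrable majorant of the event that the smallest eigenvalue of
`∑ s, x s (x s)ᵀ` falls below half of its expectation. -/
theorem exists_integrable_majorant_chernoff [Fintype ι] [IsProbabilityMeasure Pr]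
    {x : ι → Ω → n → ℝ} (hx : ∀ s, AEMeasurable (x s) Pr) (hind : iIndepFun x Pr) {B : ℝ}
    (hB : 0 < B) (hxB : ∀ s ω, x s ω ⬝ᵥ x s ω ≤ B) {R : Matrix n n ℝ}
    (hR : ∀ s i j, ∫ ω, x s ω i * x s ω j ∂Pr = R i j) {l : ℝ}
    (hl : ∀ c : n → ℝ, l * (c ⬝ᵥ c) ≤ c ⬝ᵥ R *ᵥ c) :
    ∃ H : Ω → ℝ, Integrable H Pr ∧ (∀ ω, 0 ≤ H ω) ∧
      (∀ ω, (∃ c : n → ℝ, c ⬝ᵥ (∑ s, vecMulVec (x s ω) (x s ω)) *ᵥ c <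
        Fintype.card ι * l / 2 * (c ⬝ᵥ c)) → 1 ≤ H ω) ∧
      ∫ ω, H ω ∂Pr ≤ Fintype.card n * Real.exp (-(cDelta (1 / 2) * Fintype.card ι * l / B)) := by
  -- For `l > 0` this minimizes the exponent `θSl/2 - Sl(1 - exp(-θB))/B`, with `S` the number of
  -- samples; it makes `exp(-θB) = 1/2`.
  set θ := Real.log 2 / B with hθ
  have hθ0 : 0 ≤ θ := div_nonneg (Real.log_nonneg one_le_two) hB.le
  set τ := Fintype.card ι * l / 2 with hτ
  have hsymm : ∀ ω, (∑ s, vecMulVec (x s ω) (x s ω)).IsSymm := fun ω => by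
    simpa using isSymm_smul_sum_vecMulVec Finset.univ 1 fun s => x s ω
  refine ⟨fun ω => Real.exp (θ * τ) *
    (NormedSpace.exp (-θ • ∑ s, vecMulVec (x s ω) (x s ω))).trace, ?_, ?_, ?_, ?_⟩
  · refine Integrable.const_mul ?_ _
    refine integrable_comp_of_bounded (X := fun ω s => x s ω) (aemeasurable_pi_lambda _ hx)
      (C := √B) (fun ω => (pi_norm_le_iff_of_nonneg (Real.sqrt_nonneg _)).2 fun s =>
        norm_le_of_dotProduct_self_le (hxB s ω))
      (F := fun u : ι → n → ℝ => (NormedSpace.exp (-θ • ∑ s, vecMulVec (u s) (u s))).trace) ?_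
    have htc : Continuous fun M : Matrix n n ℝ => M.trace := by fun_prop
    exact htc.comp (continuous_matrix_exp.comp (by fun_prop))
  · exact fun ω => mul_nonneg (Real.exp_nonneg _) (trace_exp_nonneg ((hsymm ω).smul _))
  · rintro ω ⟨c, hc⟩
    have h := exp_neg_le_trace_exp (hsymm ω) hθ0 hc
    calc (1 : ℝ) = Real.exp (θ * τ) * Real.exp (-(θ * τ)) := by rw [← Real.exp_add]; simp
      _ ≤ _ := mul_le_mul_of_nonneg_left h (Real.exp_nonneg _)
  · rw [integral_const_mul]
    have h := integral_trace_exp_le hx hind hB hxB hR hl hθ0 Finset.univ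
    have hhalf : Real.exp (-θ * B) = 1 / 2 := by
      rw [hθ, neg_mul, div_mul_cancel₀ _ hB.ne', Real.exp_neg, Real.exp_log two_pos, one_div]
    rw [hhalf, ← Real.exp_nat_mul, Finset.card_univ] at h
    calc _ ≤ Real.exp (θ * τ) * _ := mul_le_mul_of_nonneg_left h (Real.exp_nonneg _)
      _ = Fintype.card n * Real.exp (θ * τ +
            Fintype.card ι * -((1 - 1 / 2) / B * l)) := by rw [Real.exp_add]; ring
      _ = _ := by
        congr 2
        have : Real.log (1 - 1 / 2) = -Real.log 2 := by
          rw [← Real.log_inv]; norm_num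
        rw [cDelta, this, hθ, hτ]
        field_simp
        ring

end Chernoff

/-! ### Orthogonality in `L²` -/

/-- The discriminant is `4B²`. This turns minimality into orthogonality, both in `L²` and for the
discrete sums. -/
theorem eq_zero_of_forall_quadratic_nonneg {B C : ℝ} (h : ∀ t : ℝ, 0 ≤ t ^ 2 * C - 2 * t * B) :
    B = 0 := by
  have := discrim_le_zero (a := C) (b := -2 * B) (c := 0) fun t => by linarith [h t]
  rw [discrim] at this
  nlinarith

section Orthogonality

variable {X n : Type*} [MeasurableSpace X] {μ : Measure X}

theorem integrable_mul_of_memLp_two {g h : X → ℝ} (hg : MemLp g 2 μ) (hh : MemLp h 2 μ) :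
    Integrable (fun z => g z * h z) μ := hg.integrable_mul hh

theorem integral_mul_eq_zero_of_forall_le {g h : X → ℝ} (hg : MemLp g 2 μ) (hh : MemLp h 2 μ)
    (hmin : ∀ t : ℝ, ∫ z, g z ^ 2 ∂μ ≤ ∫ z, (g z - t * h z) ^ 2 ∂μ) : ∫ z, g z * h z ∂μ = 0 := by
  refine eq_zero_of_forall_quadratic_nonneg (C := ∫ z, h z ^ 2 ∂μ) fun t => ?_
  have e : ∫ z, (g z - t * h z) ^ 2 ∂μ =
      ∫ z, g z ^ 2 ∂μ + (t ^ 2 * ∫ z, h z ^ 2 ∂μ - 2 * t * ∫ z, g z * h z ∂μ) := by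
    have hi : Integrable (fun z => t ^ 2 * h z ^ 2 - 2 * t * (g z * h z)) μ :=
      (hh.integrable_sq.const_mul _).sub ((integrable_mul_of_memLp_two hg hh).const_mul _)
    rw [← integral_const_mul, ← integral_const_mul, ← integral_sub (hh.integrable_sq.const_mul _)
      ((integrable_mul_of_memLp_two hg hh).const_mul _), ← integral_add hg.integrable_sq hi]
    exact integral_congr_ae (Eventually.of_forall fun z => by ring)
  linarith [hmin t]

variable [Fintype n]

theorem memLp_linearCombination {φ : n → X → ℝ} (hφ : ∀ i, MemLp (φ i) 2 μ) (c : n → ℝ) :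
    MemLp (fun z => ∑ i, c i * φ i z) 2 μ :=
  memLp_finsetSum _ fun i _ => (hφ i).const_mul (c i)

theorem integral_mul_linearCombination {φ : n → X → ℝ} (hφ : ∀ i, MemLp (φ i) 2 μ) (c : n → ℝ)
    {g : X → ℝ} (hg : MemLp g 2 μ) :
    ∫ z, g z * ∑ i, c i * φ i z ∂μ = ∑ i, c i * ∫ z, g z * φ i z ∂μ := by
  simp only [Finset.mul_sum, ← integral_const_mul]
  rw [← integral_finsetSum _ fun i _ => (integrable_mul_of_memLp_two hg (hφ i)).const_mul (c i)]
  exact integral_congr_ae (Eventually.of_forall fun z =>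
    Finset.sum_congr rfl fun i _ => by ring)

theorem integral_linearCombination_sq [DecidableEq n] {φ : n → X → ℝ} (hφ : ∀ i, MemLp (φ i) 2 μ)
    (hon : ∀ i j, ∫ z, φ i z * φ j z ∂μ = if i = j then 1 else 0) (c : n → ℝ) :
    ∫ z, (∑ i, c i * φ i z) ^ 2 ∂μ = ∑ i, c i ^ 2 := by
  simp only [pow_two (∑ i, _)]
  rw [integral_mul_linearCombination hφ c (memLp_linearCombination hφ c)]
  refine Finset.sum_congr rfl fun i _ => ?_
  simp only [mul_comm _ (φ i _)]
  rw [integral_mul_linearCombination hφ c (hφ i)]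
  simp [hon, pow_two]

theorem integral_sub_linearCombination_sq [DecidableEq n] {φ : n → X → ℝ}
    (hφ : ∀ i, MemLp (φ i) 2 μ) (hon : ∀ i j, ∫ z, φ i z * φ j z ∂μ = if i = j then 1 else 0)
    (c : n → ℝ) {g : X → ℝ} (hg : MemLp g 2 μ) (hort : ∀ i, ∫ z, g z * φ i z ∂μ = 0) :
    ∫ z, (g z - ∑ i, c i * φ i z) ^ 2 ∂μ = ∫ z, g z ^ 2 ∂μ + ∑ i, c i ^ 2 := by
  have hl := memLp_linearCombination hφ c
  have h0 : ∫ z, g z * ∑ i, c i * φ i z ∂μ = 0 := by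
    rw [integral_mul_linearCombination hφ c hg]
    simp [hort]
  rw [← integral_linearCombination_sq hφ hon c]
  have : ∀ z, (g z - ∑ i, c i * φ i z) ^ 2 =
      (g z ^ 2 + (∑ i, c i * φ i z) ^ 2) - 2 * (g z * ∑ i, c i * φ i z) := fun z => by ring
  have hi : Integrable (fun z => g z ^ 2 + (∑ i, c i * φ i z) ^ 2) μ :=
    hg.integrable_sq.add hl.integrable_sq
  simp only [this]
  rw [integral_sub hi
    ((integrable_mul_of_memLp_two hg hl).const_mul 2), integral_const_mul, h0,
    integral_add hg.integrable_sq hl.integrable_sq]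
  ring

end Orthogonality

/-! ### Averages of iid random variables -/

/-- Variances of independent variables add, so the second moment is `m² + (M - m²)/S`; the term
`-m²/S` is dropped. -/
theorem integral_average_sq_le {Ω : Type*} [MeasurableSpace Ω] {Pr : Measure Ω}
    [IsProbabilityMeasure Pr] {S : ℕ} (hS : 0 < S) {Y : Fin S → Ω → ℝ}
    (hY : ∀ s, MemLp (Y s) 2 Pr) (hind : iIndepFun Y Pr) {m M : ℝ}
    (hm : ∀ s, ∫ ω, Y s ω ∂Pr = m) (hM : ∀ s, ∫ ω, Y s ω ^ 2 ∂Pr = M) :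
    Integrable (fun ω => ((S : ℝ)⁻¹ * ∑ s, Y s ω) ^ 2) Pr ∧
      ∫ ω, ((S : ℝ)⁻¹ * ∑ s, Y s ω) ^ 2 ∂Pr ≤ m ^ 2 + M / S := by
  have hS' : (0 : ℝ) < S := by exact_mod_cast hS
  have hsum : MemLp (∑ s, Y s) 2 Pr := memLp_finsetSum' _ fun s _ => hY s
  have hint := hsum.integrable_sq
  simp only [Finset.sum_apply] at hint
  have hvar := IndepFun.variance_sum (s := Finset.univ) (fun s _ => hY s)
    (fun s _ t _ hst => hind.indepFun hst)
  have hE : ∫ ω, (∑ s, Y s) ω ∂Pr = S * m := by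
    simp only [Finset.sum_apply]
    rw [integral_finsetSum _ fun s _ => (hY s).integrable one_le_two]
    simp [hm]
  rw [variance_eq_sub hsum, hE] at hvar
  have hv : ∀ s, variance (Y s) Pr = M - m ^ 2 := fun s => by
    rw [variance_eq_sub (hY s), hm s, ← hM s]
    rfl
  simp only [hv, Finset.sum_const, Finset.card_univ, Fintype.card_fin, nsmul_eq_mul] at hvar
  have e : ∫ ω, ((∑ s, Y s) ^ 2) ω ∂Pr = ∫ ω, (∑ s, Y s ω) ^ 2 ∂Pr := by
    simp [Finset.sum_apply]
  rw [e] at hvar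
  simp only [mul_pow]
  refine ⟨hint.const_mul _, ?_⟩
  rw [integral_const_mul, eq_add_of_sub_eq hvar]
  have : (S : ℝ)⁻¹ ^ 2 * (S * (M - m ^ 2) + (S * m) ^ 2) = m ^ 2 + M / S - m ^ 2 / S := by
    field_simp
    ring
  rw [this]
  have : 0 ≤ m ^ 2 / S := by positivity
  linarith

/-! ### The sampling measure and the weighted measures -/

theorem map_smul_withDensity {d : ℕ} {a : ℝ} (ha : 0 < a) {m : (Fin d → ℝ) → ℝ≥0∞}
    (hm : Measurable m) :
    ((volume.withDensity m).map fun y => a • y) =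
      volume.withDensity fun z => ENNReal.ofReal ((a ^ d)⁻¹) * m (a⁻¹ • z) := by
  have hmap := Measure.map_addHaar_smul (volume : Measure (Fin d → ℝ)) ha.ne'
  rw [Module.finrank_fin_fun, abs_of_pos (by positivity)] at hmap
  have hma : Measurable fun z : Fin d → ℝ => m (a⁻¹ • z) := hm.comp (measurable_const_smul _)
  ext A hA
  rw [Measure.map_apply (measurable_const_smul a) hA,
    withDensity_apply _ (measurable_const_smul a hA), withDensity_apply _ hA,
    lintegral_const_mul _ hma, ← smul_eq_mul, ← lintegral_smul_measure, ← Measure.restrict_smul,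
    ← hmap, setLIntegral_map hA hma (measurable_const_smul a)]
  refine lintegral_congr fun y => ?_
  rw [smul_smul, inv_mul_cancel₀ ha.ne', one_smul]

section Measures

variable {d : ℕ} {D : Set (Fin d → ℝ)} {Q : (Fin d → ℝ) → ℝ} {t : ℝ}
  {φ : (Fin d → ℕ) → MvPolynomial (Fin d) ℝ} {Λ : Finset (Fin d → ℕ)}

theorem measurable_eval (p : MvPolynomial (Fin d) ℝ) :
    Measurable fun z : Fin d → ℝ => MvPolynomial.eval z p :=
  (MvPolynomial.continuous_eval p).measurable

theorem measurable_samplingDensity : Measurable (samplingDensity D Q t Λ) :=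
  ((Measure.measurable_rnDeriv _ _).ennreal_toReal.comp (measurable_const_smul _)).const_mul _

theorem measurable_kernelDiag : Measurable (kernelDiag φ Λ) :=
  Finset.measurable_fun_sum _ fun α _ => (measurable_eval (φ α)).pow_const 2

theorem measurable_christoffelWeight : Measurable (christoffelWeight φ Λ) :=
  measurable_kernelDiag.const_div _

theorem kernelDiag_nonneg (z : Fin d → ℝ) : 0 ≤ kernelDiag φ Λ z :=
  Finset.sum_nonneg fun _ _ => sq_nonneg _

theorem christoffelWeight_nonneg (z : Fin d → ℝ) : 0 ≤ christoffelWeight φ Λ z :=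
  div_nonneg (Nat.cast_nonneg _) (kernelDiag_nonneg z)

/-- Only an inequality: where `K` vanishes, the weight `N/0` is `0` by convention. -/
theorem christoffelWeight_mul_kernelDiag_le (z : Fin d → ℝ) :
    christoffelWeight φ Λ z * kernelDiag φ Λ z ≤ Λ.card := by
  rw [christoffelWeight]
  rcases eq_or_ne (kernelDiag φ Λ z) 0 with h | h
  · simp [h]
  · rw [div_mul_cancel₀ _ h]

theorem samplingDensity_nonneg (z : Fin d → ℝ) : 0 ≤ samplingDensity D Q t Λ z :=
  mul_nonneg (Real.rpow_nonneg (Nat.cast_nonneg _) _) ENNReal.toReal_nonneg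

/-- The expanded equilibrium measure has density `v` on `D`. -/
theorem map_equilibriumMeasure (hDQ : UnboundedAdmissible D Q t)
    (hdens : equilibriumMeasure D Q ≪ volume) [IsFiniteMeasure (equilibriumMeasure D Q)]
    (hΛ : 0 < maxDegree Λ) :
    ((equilibriumMeasure D Q).map fun y => (maxDegree Λ : ℝ) ^ (1 / t) • y) =
      weightMeasure D (samplingDensity D Q t Λ) := by
  have hk : (0 : ℝ) < maxDegree Λ := by exact_mod_cast hΛ
  set a : ℝ := (maxDegree Λ : ℝ) ^ (1 / t) with ha
  have ha0 : 0 < a := Real.rpow_pos_of_pos hk _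
  have hainv : a⁻¹ = (maxDegree Λ : ℝ) ^ (-1 / t) := by
    rw [ha, ← Real.rpow_neg hk.le, neg_div]
  have had : (a ^ d)⁻¹ = (maxDegree Λ : ℝ) ^ (-(d : ℝ) / t) := by
    rw [← inv_pow, hainv, ← Real.rpow_mul_natCast hk.le]
    congr 1
    ring
  have hD : MeasurableSet D := hDQ.isClosed.measurableSet
  have hfull : volume.withDensity (fun z => ENNReal.ofReal (samplingDensity D Q t Λ z)) =
      (equilibriumMeasure D Q).map fun y => a • y := by
    conv_rhs => rw [← Measure.withDensity_rnDeriv_eq _ _ hdens]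
    rw [map_smul_withDensity ha0 (Measure.measurable_rnDeriv _ _)]
    refine withDensity_congr_ae ?_
    have hfin := Measure.rnDeriv_lt_top (equilibriumMeasure D Q) volume
    have hq : Measure.QuasiMeasurePreserving (fun z : Fin d → ℝ => a⁻¹ • z) volume volume :=
      Measure.quasiMeasurePreserving_smul volume (inv_ne_zero ha0.ne')
    -- `toReal` is harmless where the derivative is finite, hence almost everywhere; the dilation
    -- preserves null sets.
    filter_upwards [hq.ae hfin] with z hz
    rw [samplingDensity, equilibriumDensity, ENNReal.ofReal_mul (by positivity), had, hainv,
      ENNReal.ofReal_toReal]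
    rw [← hainv]
    exact hz.ne
  -- Dilations map the cone into itself, so the dilated measure is still carried by `D`.
  have hsupp : (equilibriumMeasure D Q).map (fun y => a • y) =
      ((equilibriumMeasure D Q).map fun y => a • y).restrict D := by
    refine (Measure.restrict_eq_self_of_ae_mem ?_).symm
    rw [ae_map_iff (p := fun y => y ∈ D) (measurable_const_smul a).aemeasurable hD]
    have hmem : ∀ᵐ y ∂(equilibriumMeasure D Q), y ∈ D := by
      rw [equilibriumMeasure]
      exact Measure.ae_smul_measure (ae_restrict_mem hD) _
    filter_upwards [hmem] with y hy
    exact hDQ.conic y hy a ha0.le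
  rw [hsupp, ← hfull, restrict_withDensity hD]
  rfl

theorem weightMeasure_mul {v κ : (Fin d → ℝ) → ℝ} (hv : Measurable v) (hκ : Measurable κ)
    (hv0 : ∀ z, 0 ≤ v z) :
    weightMeasure D (fun z => v z * κ z) =
      (weightMeasure D v).withDensity fun z => ENNReal.ofReal (κ z) := by
  rw [weightMeasure, weightMeasure, ← withDensity_mul _ hv.ennreal_ofReal hκ.ennreal_ofReal]
  congr 1
  ext z
  exact ENNReal.ofReal_mul (hv0 z)

theorem integral_weightMeasure {ω : (Fin d → ℝ) → ℝ}
    (hω : AEMeasurable ω (volume.restrict D)) (h0 : ∀ z, 0 ≤ ω z) (h : (Fin d → ℝ) → ℝ) :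
    ∫ z, h z ∂(weightMeasure D ω) = ∫ z in D, h z * ω z := by
  rw [weightMeasure, integral_withDensity_eq_integral_toReal_smul₀ hω.ennreal_ofReal
    (Eventually.of_forall fun _ => ENNReal.ofReal_lt_top)]
  refine integral_congr_ae (Eventually.of_forall fun z => ?_)
  simp only [ENNReal.toReal_ofReal (h0 z), smul_eq_mul, mul_comm]

theorem sqNorm_eq_ofReal_integral {μ : Measure (Fin d → ℝ)} {g : (Fin d → ℝ) → ℝ}
    (hg : MemLp g 2 μ) : sqNorm μ g = ENNReal.ofReal (∫ z, g z ^ 2 ∂μ) :=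
  (ofReal_integral_eq_lintegral_ofReal hg.integrable_sq
    (Eventually.of_forall fun _ => sq_nonneg _)).symm

theorem memLp_of_sqNorm_ne_top {μ : Measure (Fin d → ℝ)} {g : (Fin d → ℝ) → ℝ}
    (hg : AEStronglyMeasurable g μ) (h : sqNorm μ g ≠ ⊤) : MemLp g 2 μ := by
  rw [memLp_two_iff_integrable_sq hg]
  refine ⟨hg.pow 2, ?_⟩
  rw [hasFiniteIntegral_iff_ofReal (Eventually.of_forall fun _ => sq_nonneg _)]
  exact h.lt_top

end Measures

/-! ### Random weighted least squares -/

section LeastSquares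

open Matrix

theorem dotProduct_sum_vecMulVec_mulVec {n ι : Type*} [Fintype n] [Fintype ι] (x : ι → n → ℝ)
    (c : n → ℝ) : c ⬝ᵥ (∑ s, vecMulVec (x s) (x s)) *ᵥ c = ∑ s, (∑ i, c i * x s i) ^ 2 := by
  rw [Matrix.sum_mulVec, dotProduct_sum]
  refine Finset.sum_congr rfl fun s _ => ?_
  rw [vecMulVec_mulVec]
  rw [op_smul_eq_smul, dotProduct_smul, smul_eq_mul, dotProduct_comm, ← pow_two]
  rfl

/-- The coefficients of a least squares solution are controlled by the right-hand side of the
normal equations if the Gramian is well conditioned. -/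
theorem sum_sq_le_of_normal_equations {n : Type*} [Fintype n] {S : ℕ} (hS : 0 < S)
    {x : Fin S → n → ℝ} {u : Fin S → ℝ} {c : n → ℝ} {l : ℝ} (hl : 0 < l)
    (hgood : S * l / 2 * (c ⬝ᵥ c) ≤ c ⬝ᵥ (∑ s, vecMulVec (x s) (x s)) *ᵥ c)
    (hne : ∀ i, ∑ s, (u s - ∑ j, c j * x s j) * x s i = 0) :
    ∑ i, c i ^ 2 ≤ 4 / l ^ 2 * ∑ i, ((S : ℝ)⁻¹ * ∑ s, u s * x s i) ^ 2 := by
  have hS' : (0 : ℝ) < S := by exact_mod_cast hS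
  set b : n → ℝ := fun i => (S : ℝ)⁻¹ * ∑ s, u s * x s i with hb
  -- The normal equations paired with `c`; Cauchy-Schwarz and the lower bound on the Gramian then
  -- bound `|c|` by `(2/l)|b|`.
  have hquad : ∑ s, (∑ i, c i * x s i) ^ 2 = S * ∑ i, c i * b i := by
    have h1 : ∑ i, c i * ∑ s, (u s - ∑ j, c j * x s j) * x s i = 0 := by simp [hne]
    have h2 : ∑ i, c i * ∑ s, (u s - ∑ j, c j * x s j) * x s i =
        ∑ s, (u s - ∑ j, c j * x s j) * ∑ i, c i * x s i := by
      simp only [Finset.mul_sum]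
      rw [Finset.sum_comm]
      exact Finset.sum_congr rfl fun s _ => Finset.sum_congr rfl fun i _ => by ring
    have h3 : (S : ℝ) * ∑ i, c i * b i = ∑ s, u s * ∑ i, c i * x s i := by
      simp only [hb, Finset.mul_sum]
      rw [Finset.sum_comm]
      refine Finset.sum_congr rfl fun s _ => Finset.sum_congr rfl fun i _ => ?_
      field_simp
    rw [h2] at h1
    simp only [sub_mul, Finset.sum_sub_distrib] at h1
    rw [h3]
    simp only [pow_two]
    linarith
  rw [dotProduct_sum_vecMulVec_mulVec, hquad] at hgood
  have hcc : c ⬝ᵥ c = ∑ i, c i ^ 2 := by simp [dotProduct, pow_two]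
  rw [hcc] at hgood
  have hcs := Finset.sum_mul_sq_le_sq_mul_sq Finset.univ c b
  set C := ∑ i, c i ^ 2 with hC
  have hC0 : 0 ≤ C := Finset.sum_nonneg fun i _ => sq_nonneg _
  have hB0 : 0 ≤ ∑ i, b i ^ 2 := Finset.sum_nonneg fun i _ => sq_nonneg _
  have h1 : l / 2 * C ≤ ∑ i, c i * b i := by
    refine le_of_mul_le_mul_left ?_ hS'
    linarith
  rcases hC0.eq_or_lt with h0 | h0
  · rw [← h0]; positivity
  have h2 : (l / 2 * C) ^ 2 ≤ C * ∑ i, b i ^ 2 :=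
    (pow_le_pow_left₀ (by positivity) h1 2).trans hcs
  have h3 : (l / 2) ^ 2 * C ≤ ∑ i, b i ^ 2 := by
    refine le_of_mul_le_mul_left ?_ h0
    linarith
  rw [div_mul_eq_mul_div, le_div_iff₀ (by positivity)]
  linarith

/-- `V` bounds the coefficients when the empirical Gramian is well conditioned, and `H` dominates
the indicator of the opposite case. Since the alternative holds for every solution `c` at every `ω`,
the solution may be selected afterwards without measurability. -/
theorem exists_integrable_majorants_leastSquares {X n Ω : Type*} [MeasurableSpace X] [Fintype n]
    [DecidableEq n] [MeasurableSpace Ω] {Pr : Measure Ω} [IsProbabilityMeasure Pr]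
    {ν : Measure X} {S : ℕ} (hS : 0 < S) {z : Fin S → Ω → X} (hz : ∀ s, HasLaw (z s) ν Pr)
    (hind : iIndepFun z Pr) {φ : n → X → ℝ} (hφ : ∀ i, Measurable (φ i)) {κ : X → ℝ}
    (hκ : Measurable κ) (hκ0 : ∀ x, 0 ≤ κ x) {B : ℝ} (hB : 0 < B)
    (hκB : ∀ x, κ x * ∑ i, φ i x ^ 2 ≤ B) {R : Matrix n n ℝ}
    (hR : ∀ i j, ∫ x, κ x * (φ i x * φ j x) ∂ν = R i j) {l : ℝ} (hl0 : 0 < l)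
    (hl : ∀ c : n → ℝ, l * (c ⬝ᵥ c) ≤ c ⬝ᵥ R *ᵥ c) {g : X → ℝ} (hg : AEMeasurable g ν)
    (hg2 : Integrable (fun x => κ x * g x ^ 2) ν) :
    ∃ V H : Ω → ℝ, Integrable V Pr ∧ Integrable H Pr ∧ (∀ ω, 0 ≤ V ω) ∧ (∀ ω, 0 ≤ H ω) ∧
      (∀ ω (c : n → ℝ),
        (∀ i, ∑ s, κ (z s ω) * ((g (z s ω) - ∑ j, c j * φ j (z s ω)) * φ i (z s ω)) = 0) →
        ∑ i, c i ^ 2 ≤ V ω ∨ 1 ≤ H ω) ∧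
      ∫ ω, V ω ∂Pr ≤ 4 / l ^ 2 * (∑ i, (∫ x, κ x * (g x * φ i x) ∂ν) ^ 2 +
        B / S * ∫ x, κ x * g x ^ 2 ∂ν) ∧
      ∫ ω, H ω ∂Pr ≤ Fintype.card n * Real.exp (-(cDelta (1 / 2) * S * l / B)) := by
  have hE : ∀ (s : Fin S) {F : X → ℝ}, AEStronglyMeasurable F ν →
      ∫ ω, F (z s ω) ∂Pr = ∫ x, F x ∂ν := fun s F hF => by
    rw [← (hz s).map_eq] at hF ⊢
    exact (integral_map (hz s).aemeasurable hF).symm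
  have hI : ∀ (s : Fin S) {F : X → ℝ}, Integrable F ν → Integrable (fun ω => F (z s ω)) Pr :=
    fun s F hF => by
      rw [← (hz s).map_eq] at hF
      exact hF.comp_aemeasurable (hz s).aemeasurable
  -- the random vectors `√κ φ`
  set ξ : X → n → ℝ := fun x i => √(κ x) * φ i x with hξ
  have hξm : Measurable ξ := measurable_pi_lambda _ fun i => (hκ.sqrt).mul (hφ i)
  have hξξ : ∀ x i j, ξ x i * ξ x j = κ x * (φ i x * φ j x) := fun x i j => by
    simp only [hξ]
    rw [mul_mul_mul_comm, Real.mul_self_sqrt (hκ0 x)]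
  obtain ⟨H, hHi, hH0, hHbad, hHint⟩ := exists_integrable_majorant_chernoff
    (x := fun s ω => ξ (z s ω)) (fun s => hξm.comp_aemeasurable (hz s).aemeasurable)
    (hind.comp (fun _ => ξ) fun _ => hξm) hB
    (fun s ω => by
      refine le_trans (le_of_eq ?_) (hκB (z s ω))
      simp only [dotProduct, hξξ, Finset.mul_sum, pow_two])
    (R := R)
    (fun s i j => by
      simp only [hξξ]
      rw [hE s (F := fun x => κ x * (φ i x * φ j x))
        (hκ.mul ((hφ i).mul (hφ j))).aestronglyMeasurable, hR]) hl
  rw [Fintype.card_fin] at hHint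
  -- the random right-hand sides
  have hFm : ∀ i, AEMeasurable (fun x => κ x * (g x * φ i x)) ν := fun i =>
    hκ.aemeasurable.mul (hg.mul (hφ i).aemeasurable)
  -- Summing over `i` before estimating costs one factor `B`; bounding each term separately would
  -- cost a further factor, the number of basis functions.
  have hle : ∀ x, ∑ i, (κ x * (g x * φ i x)) ^ 2 ≤ B * (κ x * g x ^ 2) := fun x => by
    calc ∑ i, (κ x * (g x * φ i x)) ^ 2 = (κ x * ∑ i, φ i x ^ 2) * (κ x * g x ^ 2) := by
          rw [Finset.mul_sum, Finset.sum_mul]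
          exact Finset.sum_congr rfl fun i _ => by ring
      _ ≤ _ := mul_le_mul_of_nonneg_right (hκB x) (mul_nonneg (hκ0 x) (sq_nonneg _))
  have hF2 : ∀ i, Integrable (fun x => (κ x * (g x * φ i x)) ^ 2) ν := fun i => by
    refine (hg2.const_mul B).mono' ((hFm i).pow_const 2).aestronglyMeasurable
      (Eventually.of_forall fun x => ?_)
    rw [Real.norm_of_nonneg (sq_nonneg _)]
    exact (Finset.single_le_sum (f := fun i => (κ x * (g x * φ i x)) ^ 2)
      (fun _ _ => sq_nonneg _) (Finset.mem_univ i)).trans (hle x)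
  have havg := fun i => integral_average_sq_le hS
    (Y := fun s ω => κ (z s ω) * (g (z s ω) * φ i (z s ω)))
    (fun s => by
      have hm : AEMeasurable (fun ω => κ (z s ω) * (g (z s ω) * φ i (z s ω))) Pr := by
        have h := hFm i
        rw [← (hz s).map_eq] at h
        exact h.comp_aemeasurable (hz s).aemeasurable
      exact (memLp_two_iff_integrable_sq hm.aestronglyMeasurable).2 (hI s (hF2 i)))
    (hind.comp₀ (fun _ x => κ x * (g x * φ i x)) (fun s => (hz s).aemeasurable) fun s => by
      rw [(hz s).map_eq]
      exact hFm i)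
    (fun s => hE s (hFm i).aestronglyMeasurable)
    (fun s => hE s (hF2 i).aestronglyMeasurable)
  refine ⟨fun ω => 4 / l ^ 2 * ∑ i, ((S : ℝ)⁻¹ * ∑ s, κ (z s ω) * (g (z s ω) * φ i (z s ω))) ^ 2,
    H, (integrable_finsetSum _ fun i _ => (havg i).1).const_mul _, hHi, fun ω => by positivity,
    hH0, fun ω c hc => ?_, ?_, hHint⟩
  · by_cases hgood : S * l / 2 * (c ⬝ᵥ c) ≤
        c ⬝ᵥ (∑ s, vecMulVec (ξ (z s ω)) (ξ (z s ω))) *ᵥ c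
    · left
      have hlin : ∀ x, ∑ j, c j * ξ x j = √(κ x) * ∑ j, c j * φ j x := fun x => by
        rw [Finset.mul_sum]
        exact Finset.sum_congr rfl fun j _ => by simp only [hξ]; ring
      have h := sum_sq_le_of_normal_equations hS (x := fun s => ξ (z s ω))
        (u := fun s => √(κ (z s ω)) * g (z s ω)) hl0 hgood fun i => by
          rw [← hc i]
          refine Finset.sum_congr rfl fun s _ => ?_
          rw [hlin, ← mul_sub]
          simp only [hξ]
          rw [mul_mul_mul_comm, Real.mul_self_sqrt (hκ0 _)]
      refine h.trans (le_of_eq ?_)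
      congr 1
      refine Finset.sum_congr rfl fun i _ => ?_
      congr 2
      refine Finset.sum_congr rfl fun s _ => ?_
      simp only [hξ]
      rw [mul_mul_mul_comm, Real.mul_self_sqrt (hκ0 _)]
    · right
      refine hHbad ω ⟨c, ?_⟩
      rw [Fintype.card_fin]
      exact not_le.1 hgood
  · rw [integral_const_mul, integral_finsetSum _ fun i _ => (havg i).1]
    gcongr
    calc _ ≤ ∑ i, ((∫ x, κ x * (g x * φ i x) ∂ν) ^ 2 +
          (∫ x, (κ x * (g x * φ i x)) ^ 2 ∂ν) / S) := Finset.sum_le_sum fun i _ => (havg i).2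
      _ ≤ _ := by
        rw [Finset.sum_add_distrib, ← Finset.sum_div, ← integral_finsetSum _ fun i _ => hF2 i]
        gcongr
        rw [div_mul_eq_mul_div, ← integral_const_mul]
        refine div_le_div_of_nonneg_right ?_ (Nat.cast_nonneg S)
        exact integral_mono (integrable_finsetSum _ fun i _ => hF2 i) (hg2.const_mul B) hle

end LeastSquares

/-! ### The truncation -/

theorem truncT_eq {L : ℝ} (hL : 0 ≤ L) (x : ℝ) : truncT L x = max (-L) (min x L) := by
  rw [truncT]
  rcases lt_trichotomy x 0 with h | rfl | h
  · rw [Real.sign_of_neg h, abs_of_neg h, min_eq_left (by linarith : x ≤ L)]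
    rcases le_total (-x) L with h1 | h1
    · rw [min_eq_left h1, max_eq_right (by linarith)]; ring
    · rw [min_eq_right h1, max_eq_left (by linarith)]; ring
  · simp [hL]
  · rw [Real.sign_of_pos h, abs_of_pos h, one_mul, max_eq_right]
    exact le_min (by linarith) (by linarith)

theorem abs_sub_truncT_le {L x y : ℝ} (hx : |x| ≤ L) : |x - truncT L y| ≤ |x - y| := by
  obtain ⟨h1, h2⟩ := abs_le.1 hx
  have hL : 0 ≤ L := (abs_nonneg x).trans hx
  rw [truncT_eq hL]
  rcases le_total y L with h | h
  · rw [min_eq_left h]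
    rcases le_total (-L) y with h' | h'
    · rw [max_eq_right h']
    · rw [max_eq_left h', abs_of_nonneg (by linarith), abs_of_nonneg (by linarith)]; linarith
  · rw [min_eq_right h, max_eq_right (by linarith), abs_of_nonpos (by linarith),
      abs_of_nonpos (by linarith)]
    linarith

theorem abs_sub_truncT_le_two_mul {L x y : ℝ} (hx : |x| ≤ L) : |x - truncT L y| ≤ 2 * L := by
  have hL : 0 ≤ L := (abs_nonneg x).trans hx
  have h : |truncT L y| ≤ L := by
    rw [truncT_eq hL]
    exact abs_le.2 ⟨le_max_left _ _, max_le (by linarith) (min_le_right _ _)⟩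
  calc |x - truncT L y| ≤ |x| + |truncT L y| := abs_sub _ _
    _ ≤ 2 * L := by linarith

/-! ### The polynomial space in `L²` -/

section PolynomialSpace

variable {d : ℕ} {D : Set (Fin d → ℝ)} {Q : (Fin d → ℝ) → ℝ} {t : ℝ}
  {φ : (Fin d → ℕ) → MvPolynomial (Fin d) ℝ} {Λ : Finset (Fin d → ℕ)}

theorem exists_coeff_of_mem_polySpace {p : MvPolynomial (Fin d) ℝ} (hp : p ∈ polySpace φ Λ) :
    ∃ c : Λ → ℝ, ∀ z, MvPolynomial.eval z p = ∑ i, c i * MvPolynomial.eval z (φ i) := by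
  obtain ⟨c, rfl⟩ := Submodule.mem_span_image_finset_iff_exists_fun ℝ |>.1 hp
  exact ⟨c, fun z => by simp [map_sum, MvPolynomial.smul_eval]⟩

theorem mem_polySpace (i : Λ) : φ i ∈ polySpace φ Λ :=
  Submodule.subset_span ⟨i, i.2, rfl⟩

theorem memLp_eval_of_mem_polySpace {μ : Measure (Fin d → ℝ)}
    (he : ∀ i : Λ, MemLp (fun z => MvPolynomial.eval z (φ i)) 2 μ)
    {p : MvPolynomial (Fin d) ℝ} (hp : p ∈ polySpace φ Λ) :
    MemLp (fun z => MvPolynomial.eval z p) 2 μ := by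
  obtain ⟨c, hc⟩ := exists_coeff_of_mem_polySpace hp
  simp only [hc]
  exact memLp_linearCombination he c

theorem IsProjection.integral_mul_eq_zero {μ : Measure (Fin d → ℝ)} {f : (Fin d → ℝ) → ℝ}
    {p : MvPolynomial (Fin d) ℝ} (hp : IsProjection μ (polySpace φ Λ) f p)
    (hg : MemLp (fun z => f z - MvPolynomial.eval z p) 2 μ) {i : Λ}
    (he : MemLp (fun z => MvPolynomial.eval z (φ i)) 2 μ) :
    ∫ z, (f z - MvPolynomial.eval z p) * MvPolynomial.eval z (φ i) ∂μ = 0 := by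
  refine integral_mul_eq_zero_of_forall_le hg he fun s => ?_
  have h := hp.2 (p + s • φ i) (add_mem hp.1 (Submodule.smul_mem _ s (mem_polySpace i)))
  have e : (fun z => f z - MvPolynomial.eval z (p + s • φ i)) =
      fun z => f z - MvPolynomial.eval z p - s * MvPolynomial.eval z (φ i) := by
    ext z
    simp only [map_add, MvPolynomial.smul_eval]
    ring
  have hsub : MemLp (fun z => f z - MvPolynomial.eval z p - s * MvPolynomial.eval z (φ i)) 2 μ :=
    hg.sub (he.const_mul s)
  rw [e, sqNorm_eq_ofReal_integral hg, sqNorm_eq_ofReal_integral hsub] at h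
  exact (ENNReal.ofReal_le_ofReal_iff (integral_nonneg fun _ => sq_nonneg _)).1 h

theorem IsDiscreteLeastSquares.normal_equations {S : ℕ} (hS : 0 < S) {z : Fin S → Fin d → ℝ}
    {f : (Fin d → ℝ) → ℝ} {q : MvPolynomial (Fin d) ℝ}
    (hq : IsDiscreteLeastSquares φ Λ z f q) (i : Λ) :
    ∑ s, christoffelWeight φ Λ (z s) *
      ((f (z s) - MvPolynomial.eval (z s) q) * MvPolynomial.eval (z s) (φ i)) = 0 := by
  have hS' : (0 : ℝ) < 1 / S := by positivity
  refine eq_zero_of_forall_quadratic_nonneg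
    (C := ∑ s, christoffelWeight φ Λ (z s) * MvPolynomial.eval (z s) (φ i) ^ 2) fun t => ?_
  have h := le_of_mul_le_mul_left
    (hq.2 (q + t • φ i) (add_mem hq.1 (Submodule.smul_mem _ t (mem_polySpace i)))) hS'
  rw [← sub_nonneg, ← Finset.sum_sub_distrib] at h
  refine h.trans_eq ?_
  rw [Finset.mul_sum, Finset.mul_sum, ← Finset.sum_sub_distrib]
  refine Finset.sum_congr rfl fun s _ => ?_
  simp only [map_add, MvPolynomial.smul_eval]
  ring

/-- `φ 0` is a constant whose square integrates to `1` against the weight. A non-integrable function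
would have integral `0` by convention. -/
theorem integrableOn_weight (hφ : IsOrthonormalFamily D (weight Q) φ) :
    IntegrableOn (weight Q) D := by
  obtain ⟨c, hc⟩ : ∃ c, φ 0 = MvPolynomial.C c :=
    ⟨_, MvPolynomial.totalDegree_eq_zero_iff_eq_C.1 (by simpa using hφ.1 0)⟩
  have h := hφ.2 0 0
  simp only [hc, MvPolynomial.eval_C, if_true] at h
  have hc0 : c * c ≠ 0 := by
    intro h0
    simp [h0] at h
  have hi : IntegrableOn (fun z => c * c * weight Q z) D := by
    by_contra hn
    rw [integral_undef hn] at h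
    exact zero_ne_one h
  refine (hi.const_mul (c * c)⁻¹).congr (Eventually.of_forall fun z => ?_)
  simp only
  rw [← mul_assoc, inv_mul_cancel₀ hc0, one_mul]

theorem weight_pos (z : Fin d → ℝ) : 0 < weight Q z := Real.exp_pos _

theorem integral_mul_weightMeasure_weight (hφ : IsOrthonormalFamily D (weight Q) φ)
    (α β : Fin d → ℕ) :
    ∫ z, MvPolynomial.eval z (φ α) * MvPolynomial.eval z (φ β) ∂(weightMeasure D (weight Q)) =
      if α = β then 1 else 0 := by
  rw [integral_weightMeasure (integrableOn_weight hφ).1.aemeasurable fun z => (weight_pos z).le]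
  exact hφ.2 α β

theorem memLp_eval_weightMeasure (hφ : IsOrthonormalFamily D (weight Q) φ) (α : Fin d → ℕ) :
    MemLp (fun z => MvPolynomial.eval z (φ α)) 2 (weightMeasure D (weight Q)) := by
  rw [memLp_two_iff_integrable_sq (measurable_eval _).aestronglyMeasurable]
  by_contra hn
  have h := integral_mul_weightMeasure_weight hφ α α
  simp only [← pow_two, if_true] at h
  rw [integral_undef hn] at h
  exact zero_ne_one h

theorem weightMeasure_weight_univ (hφ : IsOrthonormalFamily D (weight Q) φ) :
    weightMeasure D (weight Q) Set.univ = ENNReal.ofReal (∫ z in D, weight Q z) := by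
  rw [weightMeasure, withDensity_apply _ MeasurableSet.univ, Measure.restrict_univ,
    ofReal_integral_eq_lintegral_ofReal (integrableOn_weight hφ)
      (Eventually.of_forall fun z => (weight_pos z).le)]

/-- The weight is positive everywhere. This carries measurability of `f` from `L²_w` to the sampling
and surrogate measures. -/
theorem restrict_absolutelyContinuous_weightMeasure (hφ : IsOrthonormalFamily D (weight Q) φ) :
    volume.restrict D ≪ weightMeasure D (weight Q) :=
  withDensity_absolutelyContinuous' (integrableOn_weight hφ).1.aemeasurable.ennreal_ofReal
    (Eventually.of_forall fun z => (ENNReal.ofReal_pos.2 (weight_pos z)).ne')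

end PolynomialSpace

/-! ### The sample size condition -/

theorem cDelta_half : cDelta (1 / 2) = (1 - Real.log 2) / 2 := by
  have : Real.log (1 - 1 / 2) = -Real.log 2 := by rw [← Real.log_inv]; norm_num
  rw [cDelta, this]
  ring

theorem cDelta_half_pos : 0 < cDelta (1 / 2) := by
  rw [cDelta_half]
  linarith [Real.log_two_lt_d9]

section SampleSize

variable {N S : ℕ} {r l : ℝ}

/-- With the eigenvalue multiplied over, the sample size condition itself forces the Gramian to be
positive definite. -/
theorem pos_of_sample_size (hr : 0 < r)
    (h : (1 + r) / cDelta (1 / 2) ≤ (S : ℝ) / (N * Real.log S) * l) : 0 < l := by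
  have h1 : 0 < (1 + r) / cDelta (1 / 2) := div_pos (by linarith) cDelta_half_pos
  have h2 : 0 ≤ (S : ℝ) / (N * Real.log S) :=
    div_nonneg (Nat.cast_nonneg _) (mul_nonneg (Nat.cast_nonneg _) (Real.log_natCast_nonneg _))
  exact pos_of_mul_pos_right (h1.trans_le h) h2

theorem sample_size_mul_le (hN : 0 < N) (hS : 2 ≤ S)
    (h : (1 + r) / cDelta (1 / 2) ≤ (S : ℝ) / (N * Real.log S) * l) :
    (1 + r) * (N * Real.log S) ≤ cDelta (1 / 2) * S * l := by
  have hN' : (0 : ℝ) < N := by exact_mod_cast hN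
  have hlog : 0 < Real.log S := Real.log_pos (by exact_mod_cast hS)
  rw [div_mul_eq_mul_div, div_le_div_iff₀ cDelta_half_pos (by positivity)] at h
  linarith

theorem epsilon_pos (hr : 0 < r) (hS : 2 ≤ S) : 0 < epsilon r S := by
  have hlog : 0 < Real.log S := Real.log_pos (by exact_mod_cast hS)
  exact div_pos (by linarith [Real.log_two_lt_d9]) (mul_pos (by linarith) hlog)

/-- The numerator of `epsilon` is exactly `4 c_{1/2}`, so this is the sample size condition
rearranged. -/
theorem four_div_sq_mul_le_epsilon (hr : 0 < r) (hN : 0 < N) (hS : 2 ≤ S) (hl : 0 < l)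
    (h : (1 + r) / cDelta (1 / 2) ≤ (S : ℝ) / (N * Real.log S) * l) :
    4 / l ^ 2 * (N / S) ≤ epsilon r S / l := by
  have hlog : 0 < Real.log S := Real.log_pos (by exact_mod_cast hS)
  have hS' : (0 : ℝ) < S := by positivity
  have h1 := sample_size_mul_le hN hS h
  have he : epsilon r S = 4 * cDelta (1 / 2) / ((1 + r) * Real.log S) := by
    rw [epsilon, cDelta_half]; ring
  rw [he, div_mul_div_comm, div_div, div_le_div_iff₀ (by positivity) (by positivity)]
  nlinarith [mul_le_mul_of_nonneg_left h1 (by positivity : 0 ≤ 4 * l)]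

/-- The condition makes the exponential at most `S^{-(1+r)}`, and the spare power of `S` absorbs the
dimension `N`. -/
theorem mul_exp_le_rpow (hr : 0 < r) (hN : 0 < N) (hS : 2 ≤ S) (hl : 0 < l) (hl1 : l ≤ 1)
    (h : (1 + r) / cDelta (1 / 2) ≤ (S : ℝ) / (N * Real.log S) * l) :
    N * Real.exp (-(cDelta (1 / 2) * S * l / N)) ≤ ((S : ℝ) ^ r)⁻¹ := by
  have hN' : (0 : ℝ) < N := by exact_mod_cast hN
  have hS2 : (2 : ℝ) ≤ S := by exact_mod_cast hS
  have hS' : (0 : ℝ) < S := by linarith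
  have hlog : Real.log 2 ≤ Real.log S := Real.log_le_log two_pos hS2
  have h1 := sample_size_mul_le hN hS h
  -- `N log 2 ≤ (1+r) N log S ≤ c_{1/2} S l ≤ S/2`, and `log 2 > 1/2`.
  have hNS : (N : ℝ) ≤ S := by
    have h2 : cDelta (1 / 2) ≤ 1 / 2 := by rw [cDelta_half]; linarith [Real.log_two_gt_d9]
    have h3 : cDelta (1 / 2) * S * l ≤ 1 / 2 * S * 1 := by
      have := cDelta_half_pos
      gcongr
    have h4 : (N : ℝ) * Real.log 2 ≤ (1 + r) * (N * Real.log S) := by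
      have : (N : ℝ) * Real.log 2 ≤ N * Real.log S := by gcongr
      have h0 : 0 ≤ N * Real.log S := mul_nonneg hN'.le (by linarith [Real.log_two_gt_d9])
      nlinarith
    nlinarith [Real.log_two_gt_d9]
  have h5 : Real.exp (-(cDelta (1 / 2) * S * l / N)) ≤ Real.exp (-((1 + r) * Real.log S)) := by
    rw [Real.exp_le_exp, neg_le_neg_iff, le_div_iff₀ hN']
    linarith
  calc N * Real.exp (-(cDelta (1 / 2) * S * l / N))
      ≤ S * Real.exp (-((1 + r) * Real.log S)) := by gcongr
    _ = ((S : ℝ) ^ r)⁻¹ := by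
      rw [Real.rpow_def_of_pos hS', ← Real.exp_neg]
      nth_rewrite 1 [← Real.exp_log hS']
      rw [← Real.exp_add]
      congr 1
      ring

theorem tendsto_epsilon (hr : 0 < r) : Tendsto (epsilon r) atTop (𝓝 0) := by
  refine Tendsto.div_atTop tendsto_const_nhds ?_
  exact (Real.tendsto_log_atTop.comp tendsto_natCast_atTop_atTop).const_mul_atTop (by linarith)

end SampleSize

/-! ### The surrogate Gramian, its bias term, and the error bound for a fixed sample. -/

section Estimator

variable {d : ℕ} {D : Set (Fin d → ℝ)} {Q : (Fin d → ℝ) → ℝ} {t : ℝ}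
  {φ : (Fin d → ℕ) → MvPolynomial (Fin d) ℝ} {Λ : Finset (Fin d → ℕ)}

theorem surrogate_weightMeasure_eq :
    weightMeasure D (surrogateWeight D Q t φ Λ) =
      (weightMeasure D (samplingDensity D Q t Λ)).withDensity
        fun z => ENNReal.ofReal (christoffelWeight φ Λ z) :=
  weightMeasure_mul measurable_samplingDensity measurable_christoffelWeight samplingDensity_nonneg

theorem integral_surrogate_weightMeasure (h : (Fin d → ℝ) → ℝ) :
    ∫ z, h z ∂(weightMeasure D (surrogateWeight D Q t φ Λ)) =
      ∫ z, christoffelWeight φ Λ z * h z ∂(weightMeasure D (samplingDensity D Q t Λ)) := by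
  rw [surrogate_weightMeasure_eq, integral_withDensity_eq_integral_toReal_smul
    measurable_christoffelWeight.ennreal_ofReal
    (Eventually.of_forall fun _ => ENNReal.ofReal_lt_top)]
  simp only [ENNReal.toReal_ofReal (christoffelWeight_nonneg _), smul_eq_mul]

theorem integrable_surrogate_weightMeasure_iff (h : (Fin d → ℝ) → ℝ) :
    Integrable h (weightMeasure D (surrogateWeight D Q t φ Λ)) ↔
      Integrable (fun z => christoffelWeight φ Λ z * h z)
        (weightMeasure D (samplingDensity D Q t Λ)) := by
  rw [surrogate_weightMeasure_eq, integrable_withDensity_iff_integrable_smul'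
    measurable_christoffelWeight.ennreal_ofReal
    (Eventually.of_forall fun _ => ENNReal.ofReal_lt_top)]
  simp only [ENNReal.toReal_ofReal (christoffelWeight_nonneg _), smul_eq_mul]

theorem gramian_surrogate_apply (i j : Λ) :
    gramian D (surrogateWeight D Q t φ Λ) φ Λ i j =
      ∫ z, MvPolynomial.eval z (φ i) * MvPolynomial.eval z (φ j)
        ∂(weightMeasure D (surrogateWeight D Q t φ Λ)) := by
  have hm : Measurable (surrogateWeight D Q t φ Λ) :=
    measurable_samplingDensity.mul measurable_christoffelWeight
  rw [integral_weightMeasure hm.aemeasurable fun z =>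
    mul_nonneg (samplingDensity_nonneg z) (christoffelWeight_nonneg z)]
  rfl

theorem kernelDiag_eq_sum_coe (z : Fin d → ℝ) :
    kernelDiag φ Λ z = ∑ i : Λ, MvPolynomial.eval z (φ i) ^ 2 :=
  (Finset.sum_coe_sort Λ fun α => MvPolynomial.eval z (φ α) ^ 2).symm

theorem christoffelWeight_mul_sum_le (z : Fin d → ℝ) :
    christoffelWeight φ Λ z * ∑ i : Λ, MvPolynomial.eval z (φ i) ^ 2 ≤ Λ.card := by
  rw [← kernelDiag_eq_sum_coe]
  exact christoffelWeight_mul_kernelDiag_le z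

theorem integrable_christoffelWeight_mul_sq
    [IsFiniteMeasure (weightMeasure D (samplingDensity D Q t Λ))] (i : Λ) :
    Integrable (fun z => christoffelWeight φ Λ z * MvPolynomial.eval z (φ i) ^ 2)
      (weightMeasure D (samplingDensity D Q t Λ)) := by
  refine Integrable.of_bound (measurable_christoffelWeight.mul
    ((measurable_eval _).pow_const 2)).aestronglyMeasurable Λ.card (Eventually.of_forall fun z => ?_)
  rw [Real.norm_of_nonneg (mul_nonneg (christoffelWeight_nonneg z) (sq_nonneg _))]
  refine le_trans ?_ (christoffelWeight_mul_sum_le (φ := φ) (Λ := Λ) z)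
  exact mul_le_mul_of_nonneg_left (Finset.single_le_sum
    (f := fun i : Λ => MvPolynomial.eval z (φ i) ^ 2) (fun _ _ => sq_nonneg _) (Finset.mem_univ i))
    (christoffelWeight_nonneg z)

theorem memLp_eval_surrogate [IsFiniteMeasure (weightMeasure D (samplingDensity D Q t Λ))] (i : Λ) :
    MemLp (fun z => MvPolynomial.eval z (φ i)) 2
      (weightMeasure D (surrogateWeight D Q t φ Λ)) := by
  rw [memLp_two_iff_integrable_sq (measurable_eval _).aestronglyMeasurable,
    integrable_surrogate_weightMeasure_iff]
  exact integrable_christoffelWeight_mul_sq i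

theorem lambdaMin_mul_le (ω : (Fin d → ℝ) → ℝ) (c : Λ → ℝ) :
    lambdaMin D ω φ Λ * (c ⬝ᵥ c) ≤ c ⬝ᵥ (gramian D ω φ Λ).mulVec c :=
  iInf_eigenvalues_mul_le (gramian_isHermitian D ω φ Λ) c

/-- Each diagonal entry of `R` is at least `λ_min`, while the trace is `∫ (N/K) K v ≤ N`. -/
theorem lambdaMin_surrogate_le_one [IsProbabilityMeasure (weightMeasure D (samplingDensity D Q t Λ))]
    (hΛ : Λ.Nonempty) : lambdaMin D (surrogateWeight D Q t φ Λ) φ Λ ≤ 1 := by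
  have hN : (0 : ℝ) < Λ.card := by exact_mod_cast hΛ.card_pos
  set ν := weightMeasure D (samplingDensity D Q t Λ) with hν
  have h1 : ∀ i : Λ, lambdaMin D (surrogateWeight D Q t φ Λ) φ Λ ≤
      ∫ z, christoffelWeight φ Λ z * MvPolynomial.eval z (φ i) ^ 2 ∂ν := fun i => by
    have h := lambdaMin_mul_le (D := D) (φ := φ) (surrogateWeight D Q t φ Λ) (Pi.single i 1)
    simp only [single_dotProduct, Pi.single_eq_same, mul_one, Matrix.mulVec_single_one,
      one_mul, Matrix.col_apply] at h
    rw [gramian_surrogate_apply, integral_surrogate_weightMeasure] at h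
    simpa only [pow_two] using h
  have h2 : ∑ _i : Λ, lambdaMin D (surrogateWeight D Q t φ Λ) φ Λ ≤ Λ.card := by
    calc _ ≤ ∑ i : Λ, ∫ z, christoffelWeight φ Λ z * MvPolynomial.eval z (φ i) ^ 2 ∂ν :=
          Finset.sum_le_sum fun i _ => h1 i
      _ = ∫ z, christoffelWeight φ Λ z * ∑ i : Λ, MvPolynomial.eval z (φ i) ^ 2 ∂ν := by
          simp only [Finset.mul_sum]
          rw [integral_finsetSum _ fun i _ => integrable_christoffelWeight_mul_sq i]
      _ ≤ ∫ _z, (Λ.card : ℝ) ∂ν := by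
          refine integral_mono ?_ (integrable_const _) christoffelWeight_mul_sum_le
          simp only [Finset.mul_sum]
          exact integrable_finsetSum _ fun i _ => integrable_christoffelWeight_mul_sq i
      _ = Λ.card := by simp
  rw [Finset.sum_const, Finset.card_univ, Fintype.card_coe, nsmul_eq_mul] at h2
  exact le_of_mul_le_mul_left (by linarith) hN

/-- The bias of the normal equations is controlled by the distance of the two projections. -/
theorem sum_integral_mul_sq_le [IsFiniteMeasure (weightMeasure D (samplingDensity D Q t Λ))]
    {f : (Fin d → ℝ) → ℝ} {p pt : MvPolynomial (Fin d) ℝ} (hp : p ∈ polySpace φ Λ)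
    (hpt : IsProjection (weightMeasure D (surrogateWeight D Q t φ Λ)) (polySpace φ Λ) f pt)
    (hg : MemLp (fun z => f z - MvPolynomial.eval z p) 2
      (weightMeasure D (surrogateWeight D Q t φ Λ)))
    (hl : 0 ≤ lambdaMin D (surrogateWeight D Q t φ Λ) φ Λ) {e : Λ → ℝ}
    (he : ∀ z, MvPolynomial.eval z (pt - p) = ∑ i, e i * MvPolynomial.eval z (φ i)) :
    ∑ i : Λ, (∫ z, (f z - MvPolynomial.eval z p) * MvPolynomial.eval z (φ i)
      ∂(weightMeasure D (surrogateWeight D Q t φ Λ))) ^ 2 ≤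
      lambdaMax D (surrogateWeight D Q t φ Λ) φ Λ ^ 2 * ∑ i, e i ^ 2 := by
  set μt := weightMeasure D (surrogateWeight D Q t φ Λ) with hμt
  have hφt : ∀ i : Λ, MemLp (fun z => MvPolynomial.eval z (φ i)) 2 μt := memLp_eval_surrogate
  have hdiff := memLp_eval_of_mem_polySpace hφt (sub_mem hpt.1 hp)
  have hgt : MemLp (fun z => f z - MvPolynomial.eval z pt) 2 μt := by
    refine (hg.sub hdiff).ae_eq (Eventually.of_forall fun z => ?_)
    simp only [Pi.sub_apply, map_sub]
    ring
  -- In `L²_w̃` the residual `f - Π̃f` is orthogonal to each `φ i`, so only `Π̃f - Πf` contributes.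
  have hβ : ∀ i : Λ, ∫ z, (f z - MvPolynomial.eval z p) * MvPolynomial.eval z (φ i) ∂μt =
      (gramian D (surrogateWeight D Q t φ Λ) φ Λ).mulVec e i := fun i => by
    have h0 := hpt.integral_mul_eq_zero hgt (hφt i)
    have h1 : ∫ z, MvPolynomial.eval z (φ i) * MvPolynomial.eval z (pt - p) ∂μt =
        (gramian D (surrogateWeight D Q t φ Λ) φ Λ).mulVec e i := by
      simp only [he]
      rw [integral_mul_linearCombination hφt e (hφt i), Matrix.mulVec, dotProduct]
      exact Finset.sum_congr rfl fun j _ => by rw [gramian_surrogate_apply, mul_comm]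
    rw [← h1, ← zero_add (∫ z, MvPolynomial.eval z (φ i) * _ ∂μt), ← h0,
      ← integral_add (integrable_mul_of_memLp_two hgt (hφt i))
        (integrable_mul_of_memLp_two (hφt i) hdiff)]
    refine integral_congr_ae (Eventually.of_forall fun z => ?_)
    simp only [map_sub]
    ring
  have h := dotProduct_mulVec_self_le (gramian_isHermitian D (surrogateWeight D Q t φ Λ) φ Λ)
    (fun x => le_trans (mul_nonneg hl (Finset.sum_nonneg fun i _ => mul_self_nonneg (x i)))
      (lambdaMin_mul_le _ x)) e
  simp only [dotProduct, ← pow_two] at h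
  simp only [hβ]
  exact h

/-- The squared error of the truncated estimator when its coefficients relative to the projection
are bounded, or else by the size of the domain. -/
theorem sqNorm_sub_truncT_le (hD : IsClosed D) (hφ : IsOrthonormalFamily D (weight Q) φ)
    {f : (Fin d → ℝ) → ℝ} {L : ℝ} (hfL : ∀ z ∈ D, |f z| ≤ L) {p q : MvPolynomial (Fin d) ℝ}
    (hp : IsProjection (weightMeasure D (weight Q)) (polySpace φ Λ) f p)
    (hg : MemLp (fun z => f z - MvPolynomial.eval z p) 2 (weightMeasure D (weight Q)))
    {c : Λ → ℝ} (hc : ∀ z, MvPolynomial.eval z (q - p) = ∑ i, c i * MvPolynomial.eval z (φ i))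
    {V H : ℝ} (hV : 0 ≤ V) (hH : 0 ≤ H) (h : ∑ i, c i ^ 2 ≤ V ∨ 1 ≤ H) :
    sqNorm (weightMeasure D (weight Q)) (fun z => f z - truncT L (MvPolynomial.eval z q)) ≤
      ENNReal.ofReal ((∫ z, (f z - MvPolynomial.eval z p) ^ 2 ∂(weightMeasure D (weight Q)) + V) +
        4 * L ^ 2 * (∫ z in D, weight Q z) * H) := by
  set μ := weightMeasure D (weight Q) with hμ
  have hmem : ∀ᵐ z ∂μ, z ∈ D :=
    (withDensity_absolutelyContinuous _ _).ae_le (ae_restrict_mem hD.measurableSet)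
  have hφ2 : ∀ i : Λ, MemLp (fun z => MvPolynomial.eval z (φ i)) 2 μ := fun i =>
    memLp_eval_weightMeasure hφ i
  have hI : 0 ≤ ∫ z, (f z - MvPolynomial.eval z p) ^ 2 ∂μ := integral_nonneg fun _ => sq_nonneg _
  have hW : 0 ≤ ∫ z in D, weight Q z := integral_nonneg fun z => (weight_pos z).le
  rcases h with h | h
  · have hgq : ∀ z, f z - MvPolynomial.eval z q =
        f z - MvPolynomial.eval z p - ∑ i, c i * MvPolynomial.eval z (φ i) := fun z => by
      rw [← hc, map_sub]; ring
    have hlp : MemLp (fun z => f z - MvPolynomial.eval z q) 2 μ := by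
      simp only [hgq]
      exact hg.sub (memLp_linearCombination hφ2 c)
    calc sqNorm μ (fun z => f z - truncT L (MvPolynomial.eval z q))
        ≤ sqNorm μ (fun z => f z - MvPolynomial.eval z q) := by
          refine lintegral_mono_ae ?_
          filter_upwards [hmem] with z hz
          exact ENNReal.ofReal_le_ofReal (sq_le_sq.2 (abs_sub_truncT_le (hfL z hz)))
      _ = ENNReal.ofReal (∫ z, (f z - MvPolynomial.eval z p) ^ 2 ∂μ + ∑ i, c i ^ 2) := by
          rw [sqNorm_eq_ofReal_integral hlp]
          simp only [hgq]
          rw [integral_sub_linearCombination_sq hφ2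
            (fun i j => (integral_mul_weightMeasure_weight hφ i j).trans
              (if_congr Subtype.ext_iff.symm rfl rfl)) c hg
            fun i => hp.integral_mul_eq_zero hg (hφ2 i)]
      _ ≤ _ := by
          refine ENNReal.ofReal_le_ofReal ?_
          have : 0 ≤ 4 * L ^ 2 * (∫ z in D, weight Q z) * H := by positivity
          linarith
  · calc sqNorm μ (fun z => f z - truncT L (MvPolynomial.eval z q))
        ≤ ∫⁻ _z, ENNReal.ofReal (4 * L ^ 2) ∂μ := by
          refine lintegral_mono_ae ?_
          filter_upwards [hmem] with z hz
          refine ENNReal.ofReal_le_ofReal ?_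
          have h1 := abs_sub_truncT_le_two_mul (y := MvPolynomial.eval z q) (hfL z hz)
          have h2 := pow_le_pow_left₀ (abs_nonneg _) h1 2
          rw [sq_abs] at h2
          linarith
      _ = ENNReal.ofReal (4 * L ^ 2 * ∫ z in D, weight Q z) := by
          rw [lintegral_const, hμ, weightMeasure_weight_univ hφ, ← ENNReal.ofReal_mul (by positivity)]
      _ ≤ _ := by
          refine ENNReal.ofReal_le_ofReal ?_
          have : 4 * L ^ 2 * (∫ z in D, weight Q z) * 1 ≤ 4 * L ^ 2 * (∫ z in D, weight Q z) * H := by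
            gcongr
          linarith

end Estimator

/-- The error bound for the truncated weighted least squares estimator. -/
theorem lintegral_sqNorm_sub_truncT_le {d : ℕ} (D : Set (Fin d → ℝ)) (Q : (Fin d → ℝ) → ℝ) (t : ℝ)
    (hDQ : UnboundedAdmissible D Q t)
    (hdens : equilibriumMeasure D Q ≪ volume)
    (φ : (Fin d → ℕ) → MvPolynomial (Fin d) ℝ)
    (hφ : IsOrthonormalFamily D (weight Q) φ)
    (Λ : Finset (Fin d → ℕ)) (hΛ : 0 < maxDegree Λ)
    (f : (Fin d → ℝ) → ℝ) (L : ℝ)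
    (hf : MemLp f 2 (weightMeasure D (weight Q))) (hfL : ∀ z ∈ D, |f z| ≤ L)
    (p pt : MvPolynomial (Fin d) ℝ)
    (hp : IsProjection (weightMeasure D (weight Q)) (polySpace φ Λ) f p)
    (hpt : IsProjection (weightMeasure D (surrogateWeight D Q t φ Λ)) (polySpace φ Λ) f pt)
    {Ω : Type*} [MeasurableSpace Ω] (Pr : Measure Ω) [IsProbabilityMeasure Pr]
    (S : ℕ) (hS : 2 ≤ S) (y : Fin S → Ω → Fin d → ℝ)
    (hy : ∀ s, HasLaw (y s) (equilibriumMeasure D Q) Pr) (hindep : iIndepFun y Pr)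
    (phat : Ω → MvPolynomial (Fin d) ℝ)
    (hphat : ∀ ω, IsDiscreteLeastSquares φ Λ
      (fun s => (maxDegree Λ : ℝ) ^ (1 / t) • y s ω) f (phat ω))
    (r : ℝ) (hr : 0 < r)
    (hsample : (1 + r) / cDelta (1 / 2) ≤
      (S : ℝ) / ((Λ.card : ℝ) * Real.log S) * lambdaMin D (surrogateWeight D Q t φ Λ) φ Λ) :
    ∫⁻ ω, sqNorm (weightMeasure D (weight Q))
          (fun z => f z - truncT L (MvPolynomial.eval z (phat ω))) ∂Pr ≤
        sqNorm (weightMeasure D (weight Q)) (fun z => f z - MvPolynomial.eval z p) +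
        ENNReal.ofReal (epsilon r S / lambdaMin D (surrogateWeight D Q t φ Λ) φ Λ) *
          sqNorm (weightMeasure D (surrogateWeight D Q t φ Λ))
            (fun z => f z - MvPolynomial.eval z p) +
        ENNReal.ofReal (8 * L ^ 2 * (∫ z in D, weight Q z) / (S : ℝ) ^ r) +
        ENNReal.ofReal (4 * (lambdaMax D (surrogateWeight D Q t φ Λ) φ Λ /
            lambdaMin D (surrogateWeight D Q t φ Λ) φ Λ) ^ 2) *
          sqNorm (weightMeasure D (weight Q))
            (fun z => MvPolynomial.eval z pt - MvPolynomial.eval z p) := by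
  have hN : Λ.Nonempty := by
    rw [Finset.nonempty_iff_ne_empty]
    rintro rfl
    simp [maxDegree] at hΛ
  have hN0 : 0 < Λ.card := hN.card_pos
  have hN' : (0 : ℝ) < Λ.card := by exact_mod_cast hN0
  have hS0 : 0 < S := by omega
  have hl := pos_of_sample_size hr hsample
  have hε := epsilon_pos hr hS
  set l := lambdaMin D (surrogateWeight D Q t φ Λ) φ Λ with hl_def
  set μ := weightMeasure D (weight Q) with hμ
  set μt := weightMeasure D (surrogateWeight D Q t φ Λ) with hμt
  -- An infinite surrogate residual makes the right side infinite, because its coefficient `ε(S)/l`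
  -- is strictly positive.
  by_cases htop : sqNorm μt (fun z => f z - MvPolynomial.eval z p) = ⊤
  · rw [htop, ENNReal.mul_top (ENNReal.ofReal_pos.2 (div_pos hε hl)).ne']
    simp
  -- the law of the expanded samples
  set ν := weightMeasure D (samplingDensity D Q t Λ) with hν
  -- The total mass is read off from the law of a sample, without pluripotential theory.
  have hprob : IsProbabilityMeasure (equilibriumMeasure D Q) :=
    (hy ⟨0, hS0⟩).isProbabilityMeasure_iff.1 inferInstance
  have hmap := map_equilibriumMeasure hDQ hdens hΛ
  have hsm : Measurable fun y : Fin d → ℝ => (maxDegree Λ : ℝ) ^ (1 / t) • y :=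
    measurable_const_smul _
  have hνprob : IsProbabilityMeasure ν := by
    rw [hν, ← hmap]
    exact Measure.isProbabilityMeasure_map hsm.aemeasurable
  have hz : ∀ s, HasLaw (fun ω => (maxDegree Λ : ℝ) ^ (1 / t) • y s ω) ν Pr := fun s =>
    ⟨hsm.comp_aemeasurable (hy s).aemeasurable, by
      rw [hν, ← hmap, ← (hy s).map_eq, AEMeasurable.map_map_of_aemeasurable hsm.aemeasurable
        (hy s).aemeasurable]
      rfl⟩
  -- square integrability of the residual
  have hνμ : ν ≪ μ := (withDensity_absolutelyContinuous _ _).trans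
    (restrict_absolutelyContinuous_weightMeasure hφ)
  have hμtμ : μt ≪ μ := by
    refine Measure.AbsolutelyContinuous.trans ?_ hνμ
    rw [hμt, surrogate_weightMeasure_eq]
    exact withDensity_absolutelyContinuous _ _
  have hφ2 : ∀ i : Λ, MemLp (fun z => MvPolynomial.eval z (φ i)) 2 μ := fun i =>
    memLp_eval_weightMeasure hφ i
  have hg : MemLp (fun z => f z - MvPolynomial.eval z p) 2 μ :=
    hf.sub (memLp_eval_of_mem_polySpace hφ2 hp.1)
  have hgt : MemLp (fun z => f z - MvPolynomial.eval z p) 2 μt :=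
    memLp_of_sqNorm_ne_top (hg.1.mono_ac hμtμ) htop
  -- the random part
  have hlcond : ∀ c : Λ → ℝ, l * (c ⬝ᵥ c) ≤
      c ⬝ᵥ (gramian D (surrogateWeight D Q t φ Λ) φ Λ).mulVec c := lambdaMin_mul_le _
  obtain ⟨V, H, hVi, hHi, hV0, hH0, hVH, hVint, hHint⟩ := exists_integrable_majorants_leastSquares
    hS0 hz (hindep.comp (fun _ y => (maxDegree Λ : ℝ) ^ (1 / t) • y) fun _ => hsm)
    (φ := fun (i : Λ) z => MvPolynomial.eval z (φ i)) (fun i => measurable_eval _)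
    (measurable_christoffelWeight (φ := φ) (Λ := Λ)) christoffelWeight_nonneg hN'
    christoffelWeight_mul_sum_le
    (fun i j => by rw [gramian_surrogate_apply, integral_surrogate_weightMeasure]) hl hlcond
    (g := fun z => f z - MvPolynomial.eval z p) (hg.1.mono_ac hνμ).aemeasurable
    ((integrable_surrogate_weightMeasure_iff _).1 hgt.integrable_sq)
  rw [Fintype.card_coe] at hHint
  have htransfer : ∀ h : (Fin d → ℝ) → ℝ,
      ∫ z, christoffelWeight φ Λ z * h z ∂ν = ∫ z, h z ∂μt := fun h =>
    (integral_surrogate_weightMeasure h).symm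
  simp only [htransfer] at hVint
  obtain ⟨e, he⟩ := exists_coeff_of_mem_polySpace (sub_mem hpt.1 hp.1)
  have hbias := sum_integral_mul_sq_le hp.1 hpt hgt hl.le he
  have hd : sqNorm μ (fun z => MvPolynomial.eval z pt - MvPolynomial.eval z p) =
      ENNReal.ofReal (∑ i, e i ^ 2) := by
    simp only [← map_sub, he]
    rw [sqNorm_eq_ofReal_integral (memLp_linearCombination hφ2 e),
      integral_linearCombination_sq hφ2 (fun i j =>
        (integral_mul_weightMeasure_weight hφ i j).trans (if_congr Subtype.ext_iff.symm rfl rfl))]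
  have hbad := mul_exp_le_rpow hr hN0 hS hl (lambdaMin_surrogate_le_one hN) hsample
  have hvar := four_div_sq_mul_le_epsilon hr hN0 hS hl hsample
  set W := ∫ z in D, weight Q z with hW_def
  have hW : 0 ≤ W := integral_nonneg fun z => (weight_pos z).le
  set I := ∫ z, (f z - MvPolynomial.eval z p) ^ 2 ∂μ with hI_def
  set It := ∫ z, (f z - MvPolynomial.eval z p) ^ 2 ∂μt with hIt_def
  have hI : 0 ≤ I := integral_nonneg fun _ => sq_nonneg _
  have hIt : 0 ≤ It := integral_nonneg fun _ => sq_nonneg _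
  set lM := lambdaMax D (surrogateWeight D Q t φ Λ) φ Λ with hlM
  have hE0 : 0 ≤ ∑ i, e i ^ 2 := Finset.sum_nonneg fun _ _ => sq_nonneg _
  have hSr : 0 < (S : ℝ) ^ r := Real.rpow_pos_of_pos (by exact_mod_cast hS0) r
  calc ∫⁻ ω, sqNorm μ (fun z => f z - truncT L (MvPolynomial.eval z (phat ω))) ∂Pr
      ≤ ∫⁻ ω, ENNReal.ofReal ((I + V ω) + 4 * L ^ 2 * W * H ω) ∂Pr := by
        refine lintegral_mono fun ω => ?_
        obtain ⟨c, hc⟩ := exists_coeff_of_mem_polySpace (sub_mem (hphat ω).1 hp.1)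
        refine sqNorm_sub_truncT_le hDQ.isClosed hφ hfL hp hg hc (hV0 ω) (hH0 ω) (hVH ω c fun i => ?_)
        rw [← (hphat ω).normal_equations hS0 i]
        refine Finset.sum_congr rfl fun s _ => ?_
        rw [← hc, map_sub]
        ring
    _ = ENNReal.ofReal ((I + ∫ ω, V ω ∂Pr) + 4 * L ^ 2 * W * ∫ ω, H ω ∂Pr) := by
        have hi : Integrable (fun ω => I + V ω) Pr := (integrable_const _).add hVi
        have hi' : Integrable (fun ω => I + V ω + 4 * L ^ 2 * W * H ω) Pr :=
          hi.add (hHi.const_mul _)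
        rw [← ofReal_integral_eq_lintegral_ofReal hi'
          (Eventually.of_forall fun ω => add_nonneg (add_nonneg hI (hV0 ω))
            (mul_nonneg (by positivity) (hH0 ω))),
          integral_add hi (hHi.const_mul _), integral_add (integrable_const _) hVi,
          integral_const_mul]
        simp
    _ ≤ ENNReal.ofReal (I + epsilon r S / l * It + 8 * L ^ 2 * W / (S : ℝ) ^ r +
          4 * (lM / l) ^ 2 * ∑ i, e i ^ 2) := by
        refine ENNReal.ofReal_le_ofReal ?_
        -- The bad case costs only `4L²W`; the constant `8` leaves room.
        have h1 : 4 * L ^ 2 * W * ∫ ω, H ω ∂Pr ≤ 8 * L ^ 2 * W / (S : ℝ) ^ r := by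
          calc 4 * L ^ 2 * W * ∫ ω, H ω ∂Pr ≤ 8 * L ^ 2 * W * ((S : ℝ) ^ r)⁻¹ := by
                refine mul_le_mul ?_ (hHint.trans hbad) (integral_nonneg hH0) (by positivity)
                have : 0 ≤ L ^ 2 * W := by positivity
                linarith
            _ = _ := (div_eq_mul_inv _ _).symm
        have h2 : ∫ ω, V ω ∂Pr ≤ epsilon r S / l * It + 4 * (lM / l) ^ 2 * ∑ i, e i ^ 2 := by
          calc ∫ ω, V ω ∂Pr ≤ 4 / l ^ 2 * (lM ^ 2 * ∑ i, e i ^ 2 + Λ.card / S * It) := by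
                refine hVint.trans ?_
                gcongr
            _ = 4 / l ^ 2 * (Λ.card / S) * It + 4 * (lM / l) ^ 2 * ∑ i, e i ^ 2 := by
                rw [div_pow]
                ring
            _ ≤ _ := by gcongr
        linarith
    _ = _ := by
        rw [hd, sqNorm_eq_ofReal_integral hg, sqNorm_eq_ofReal_integral hgt,
          ← ENNReal.ofReal_mul (div_pos hε hl).le, ← ENNReal.ofReal_mul (by positivity),
          ← ENNReal.ofReal_add hI (by positivity), ← ENNReal.ofReal_add (by positivity)
          (by positivity), ← ENNReal.ofReal_add (by positivity) (by positivity)]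

end CLS

theorem mainTheorem4 {d : ℕ} (D : Set (Fin d → ℝ)) (Q : (Fin d → ℝ) → ℝ) (t : ℝ)
    (hDQ : UnboundedAdmissible D Q t)
    -- the equilibrium measure has a Lebesgue density
    (hdens : equilibriumMeasure D Q ≪ volume)
    -- the orthonormal polynomials and the index set
    (φ : (Fin d → ℕ) → MvPolynomial (Fin d) ℝ)
    (hφ : IsOrthonormalFamily D (weight Q) φ)
    (Λ : Finset (Fin d → ℕ)) (hΛ : 0 < maxDegree Λ)
    -- the function
    (f : (Fin d → ℝ) → ℝ) (L : ℝ)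
    (hf : MemLp f 2 (weightMeasure D (weight Q))) (hfL : ∀ z ∈ D, |f z| ≤ L)
    -- the projections of `f` in `L²_w` and in `L²_w̃`
    (p pt : MvPolynomial (Fin d) ℝ)
    (hp : IsProjection (weightMeasure D (weight Q)) (polySpace φ Λ) f p)
    (hpt : IsProjection (weightMeasure D (surrogateWeight D Q t φ Λ)) (polySpace φ Λ) f pt)
    -- the iid samples `y_s` from the equilibrium measure, and the expanded samples `k^{1/t} y_s`
    {Ω : Type*} [MeasurableSpace Ω] (Pr : Measure Ω) [IsProbabilityMeasure Pr]
    (S : ℕ) (hS : 2 ≤ S) (y : Fin S → Ω → Fin d → ℝ)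
    (hy : ∀ s, HasLaw (y s) (equilibriumMeasure D Q) Pr) (hindep : iIndepFun y Pr)
    -- the least-squares approximation
    (phat : Ω → MvPolynomial (Fin d) ℝ)
    (hphat : ∀ ω, IsDiscreteLeastSquares φ Λ
      (fun s => (maxDegree Λ : ℝ) ^ (1 / t) • y s ω) f (phat ω))
    -- the sample size condition `S / (N log S) ≥ ((1 + r) / c_δ) / λ_min(R)` with `δ = 1/2`
    (r : ℝ) (hr : 0 < r)
    (hsample : (1 + r) / cDelta (1 / 2) ≤
      (S : ℝ) / ((Λ.card : ℝ) * Real.log S) * lambdaMin D (surrogateWeight D Q t φ Λ) φ Λ) :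
    (∫⁻ ω, sqNorm (weightMeasure D (weight Q))
          (fun z => f z - truncT L (MvPolynomial.eval z (phat ω))) ∂Pr ≤
        sqNorm (weightMeasure D (weight Q)) (fun z => f z - MvPolynomial.eval z p) +
        ENNReal.ofReal (epsilon r S / lambdaMin D (surrogateWeight D Q t φ Λ) φ Λ) *
          sqNorm (weightMeasure D (surrogateWeight D Q t φ Λ))
            (fun z => f z - MvPolynomial.eval z p) +
        ENNReal.ofReal (8 * L ^ 2 * (∫ z in D, weight Q z) / (S : ℝ) ^ r) +
        ENNReal.ofReal (4 * (lambdaMax D (surrogateWeight D Q t φ Λ) φ Λ /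
            lambdaMin D (surrogateWeight D Q t φ Λ) φ Λ) ^ 2) *
          sqNorm (weightMeasure D (weight Q))
            (fun z => MvPolynomial.eval z pt - MvPolynomial.eval z p)) ∧
    ((∫ z in D, weight Q z) ≤ 1 →
      ∫⁻ ω, sqNorm (weightMeasure D (weight Q))
          (fun z => f z - truncT L (MvPolynomial.eval z (phat ω))) ∂Pr ≤
        sqNorm (weightMeasure D (weight Q)) (fun z => f z - MvPolynomial.eval z p) +
        ENNReal.ofReal (epsilon r S / lambdaMin D (surrogateWeight D Q t φ Λ) φ Λ) *
          sqNorm (weightMeasure D (surrogateWeight D Q t φ Λ))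
            (fun z => f z - MvPolynomial.eval z p) +
        ENNReal.ofReal (8 * L ^ 2 / (S : ℝ) ^ r) +
        ENNReal.ofReal (4 * (lambdaMax D (surrogateWeight D Q t φ Λ) φ Λ /
            lambdaMin D (surrogateWeight D Q t φ Λ) φ Λ) ^ 2) *
          sqNorm (weightMeasure D (weight Q))
            (fun z => MvPolynomial.eval z pt - MvPolynomial.eval z p)) ∧
    Tendsto (epsilon r) atTop (𝓝 0) := by
  have h := lintegral_sqNorm_sub_truncT_le D Q t hDQ hdens φ hφ Λ hΛ f L hf hfL p pt hp hpt Pr S hS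
    y hy hindep phat hphat r hr hsample
  refine ⟨h, fun hW => h.trans ?_, tendsto_epsilon hr⟩
  have h8 : 8 * L ^ 2 * (∫ z in D, weight Q z) ≤ 8 * L ^ 2 :=
    mul_le_of_le_one_right (by positivity) hW
  gcongr
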